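/- **Setting.** Let $a<b$. All sets below are subsets of $\mathbb R$, and $d_H$ is the Hausdorff metric. A *hole* consists of an interval $[c,d]$ and functions $g,h$ on it; its *region* is $\{(x,y):c<x<d,\ g(x)<y<h(x)\}$. Given functions $\ell,u$ and finitely many holes $(c_j,d_j,g_j,h_j)$, the *set-valued function with these boundaries* has as its value at $x$ the compact interval with end points $\ell(x),u(x)$ from which all open intervals $(g_j(x),h_j(x))$ with $x\in[c_j,d_j]$ are removed. The class $\mathcal F([a,b],M)$ consists of the set-valued functions $F$ on $[a,b]$ with non-empty compact values, with $F(a),F(b)$ convex, that are the set-valued function with boundaries $\ell=\min F(\cdot)$, $u=\max F(\cdot)$ and some $M$ holes with the following properties: $a<c_j<d_j<b$; $g_j,h_j$ are continuous on $[c_j,d_j]$, are equal at $c_j$ and at $d_j$, and satisfy $g_j<h_j$ on $(c_j,d_j)$; $\ell<g_j$ and $h_j<u$ on $[c_j,d_j]$; the closures of the regions of the holes are pairwise disjoint. $F\in Lip([a,b],L)$ means $d_H(F(x),F(y))\le L|x-y|$ on $[a,b]$. **Significant metric chains.** A pair $(v,w)\in V\times W$ is a *metric pair* of $(V,W)$ if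 $|v-w|=\operatorname{dist}(w,V)$ or $|v-w|=\operatorname{dist}(v,W)$. A *metric chain* of sets $S_0,\dots,S_N$ is a tuple $(f_0,\dots,f_N)$ with $f_i\in S_i$ for all $i$ and $(f_i,f_{i+1})$ a metric pair of $(S_i,S_{i+1})$ for $0\le i<N$. A *gap* of a set $A$ is a pair $p<q$ of points of $A$ with $(p,q)\cap A=\emptyset$; its midpoint is $(p+q)/2$. Let $APCT_i$ be the set of all $p\in S_i$ that are the midpoint of a gap of $S_j$ for some $j$ with $|j-i|=1$ (hence $p\notin S_j$). Let $EP_{R,i}$ (respectively $EP_{L,i}$) be the set of all $p\in S_i$ such that, for some $j<i$ (respectively $j>i$), $p\in APCT_j$ and $p\in S_l$ for all $l$ strictly between $i$ and $j$. Let $T_i$ be the union of $APCT_i$, $EP_{R,i}$, $EP_{L,i}$ and the set of end points of the maximal intervals of $S_i$. A *significant metric chain* is a metric chain of $S_0,\dots,S_N$ that is also a metric chain of $T_0,\dots,T_N$. **The algorithm.** The input is a set of points $x_0<\dots<x_N$ in $[a,b]$ and samples $S_i=F(x_i)$. An *approximated hole* consists of indices $s,t$ with $s+1<t$ and two significant metric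 chains $f,f'$ such that $(f_i,f'_i)$ is a gap of $S_i$ for all $s<i<t$, and $f_s=f'_s$, $f_t=f'_t$; moreover $f_s$ is the midpoint of $(f_{s+1},f'_{s+1})$ if this midpoint belongs to $S_s$, and $f_t$ is the midpoint of $(f_{t-1},f'_{t-1})$ if this midpoint belongs to $S_t$. The algorithm chooses finitely many approximated holes such that each gap $(p,q)$ of each sample $S_i$ equals $(f_i,f'_i)$ with $s<i<t$ for exactly one of them. For each chosen hole, let $\tilde g,\tilde h$ be the polynomials of degree at most $N$ that interpolate $f,f'$ at $x_0,\dots,x_N$, and take $(x_s,x_t,\tilde g,\tilde h)$ as a hole. Let $\tilde\ell,\tilde u$ be the polynomials of degree at most $N$ that interpolate $\min S_i$ and $\max S_i$. An *output* $\tilde F_N$ is the set-valued function with the boundaries $\tilde\ell,\tilde u$ and these holes. **Theorem.** Let $F\in Lip([a,b],L)\cap\mathcal F([a,b],M)$, and for each $N$ let the algorithm be applied to the samples of $F$ at the $N+1$ Chebyshev points of $[a,b]$, that is, $$x_i=\tfrac{a+b}2-\tfrac{b-a}2\cos\tfrac{(2i+1)\pi}{2(N+1)},\qquad 0\le i\le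 N.$$ Then there are constants $C$ and $N_0$ such that for all $N\ge N_0$ the algorithm has an output, and every output $\tilde F_N$ has non-empty compact values on $[a,b]$ and satisfies $$d_H(\tilde F_N(x),F(x))\le C\,\frac{\log N}{N}\qquad\text{for all }x\in[a,b].$$ -/

import Mathlib

namespace SVF

noncomputable section

/-! ### Sets, metric pairs and metric chains -/

/-- `(v, w)` is a metric pair of `(V, W)`: `v ∈ V`, `w ∈ W`, and `v` is a point of `V` closest
to `w` or `w` is a point of `W` closest to `v`. -/
def IsMetricPair (V W : Set ℝ) (v w : ℝ) : Prop :=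
  v ∈ V ∧ w ∈ W ∧ (|v - w| = Metric.infDist w V ∨ |v - w| = Metric.infDist v W)

/-- `f` is a metric chain of the finite sequence of sets `S 0, …, S N`. -/
def IsMetricChain {N : ℕ} (S : Fin (N + 1) → Set ℝ) (f : Fin (N + 1) → ℝ) : Prop :=
  (∀ i, f i ∈ S i) ∧
    ∀ i : Fin N, IsMetricPair (S i.castSucc) (S i.succ) (f i.castSucc) (f i.succ)

/-- `[p, q]` is a maximal interval of `A`. -/
def IsMaximalInterval (A : Set ℝ) (p q : ℝ) : Prop :=
  p ≤ q ∧ Set.Icc p q ⊆ A ∧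
    ∀ p' q' : ℝ, p' ≤ p → q ≤ q' → Set.Icc p' q' ⊆ A → p' = p ∧ q' = q

/-- The discrete sample of `A`: the set of end points of its maximal intervals. -/
def discreteSample (A : Set ℝ) : Set ℝ :=
  {y | ∃ p q : ℝ, IsMaximalInterval A p q ∧ (y = p ∨ y = q)}

/-- `p` and `q` bound a gap of `A`: for a finite union `A` of compact intervals this says that
`p` is the maximum of one maximal interval of `A` and `q` the minimum of the next one. -/
def IsGap (A : Set ℝ) (p q : ℝ) : Prop :=
  p < q ∧ p ∈ A ∧ q ∈ A ∧ Disjoint (Set.Ioo p q) A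

/-! ### Holes and the class of set-valued functions -/

/-- An interval `[c, d]` with two functions `g`, `h` on it, the lower and the upper boundary
function of a (true or approximated) hole. Only the values of `g`, `h` on `[c, d]` matter. -/
structure HoleData where
  c : ℝ
  d : ℝ
  g : ℝ → ℝ
  h : ℝ → ℝ

/-- The open region between the two boundary functions. -/
def HoleData.region (H : HoleData) : Set (ℝ × ℝ) :=
  {z | z.1 ∈ Set.Ioo H.c H.d ∧ H.g z.1 < z.2 ∧ z.2 < H.h z.1}

/-- The set-valued function with lower boundary `l`, upper boundary `u` and holes `H j`: its value
at `x` is the compact interval with end points `l x`, `u x`, from which the open sections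
`(g_j(x), h_j(x))` of the holes with `x ∈ [c_j, d_j]` are removed. If the sections at `x` are
numbered upwards this is `[l, g_1] ∪ [h_1, g_2] ∪ … ∪ [h_J, u]`. -/
def ofBoundaries {ι : Type} (l u : ℝ → ℝ) (H : ι → HoleData) (x : ℝ) : Set ℝ :=
  Set.uIcc (l x) (u x) \
    {y | ∃ j, x ∈ Set.Icc (H j).c (H j).d ∧ y ∈ Set.Ioo ((H j).g x) ((H j).h x)}

/-- The lower boundary function of `F`. -/
def lower (F : ℝ → Set ℝ) (x : ℝ) : ℝ := sInf (F x)

/-- The upper boundary function of `F`. -/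
def upper (F : ℝ → Set ℝ) (x : ℝ) : ℝ := sSup (F x)

/-- `H` lists the `M` separated simple holes of the set-valued function `F` on `[a, b]`. -/
structure HasHoles (a b : ℝ) {M : ℕ} (F : ℝ → Set ℝ) (H : Fin M → HoleData) : Prop where
  left_lt : ∀ j, a < (H j).c
  lt : ∀ j, (H j).c < (H j).d
  lt_right : ∀ j, (H j).d < b
  /- each hole is the interior of a closed curve, cut twice by each vertical line over `(c, d)` -/
  continuousOn_g : ∀ j, ContinuousOn (H j).g (Set.Icc (H j).c (H j).d)
  continuousOn_h : ∀ j, ContinuousOn (H j).h (Set.Icc (H j).c (H j).d)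
  eq_left : ∀ j, (H j).g (H j).c = (H j).h (H j).c
  eq_right : ∀ j, (H j).g (H j).d = (H j).h (H j).d
  g_lt_h : ∀ j, ∀ x ∈ Set.Ioo (H j).c (H j).d, (H j).g x < (H j).h x
  /- the closures of the holes are disjoint -/
  separated : ∀ j k, j ≠ k → Disjoint (closure (H j).region) (closure (H k).region)
  /- the boundary curves do not meet the lower and the upper boundary of the graph -/
  lower_lt : ∀ j, ∀ x ∈ Set.Icc (H j).c (H j).d, lower F x < (H j).g x
  lt_upper : ∀ j, ∀ x ∈ Set.Icc (H j).c (H j).d, (H j).h x < upper F x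
  /- outside of the holes the graph is filled -/
  eq_ofBoundaries : ∀ x ∈ Set.Icc a b, F x = ofBoundaries (lower F) (upper F) H x

/-- The class of set-valued functions on `[a, b]` (with non-empty compact values in `ℝ`)
whose graph has `M` separated holes. Only the values of `F` on `[a, b]` matter. -/
def MemClass (a b : ℝ) (M : ℕ) (F : ℝ → Set ℝ) : Prop :=
  (∀ x ∈ Set.Icc a b, (F x).Nonempty ∧ IsCompact (F x)) ∧
    Convex ℝ (F a) ∧ Convex ℝ (F b) ∧ ∃ H : Fin M → HoleData, HasHoles a b F H

/-- `F` is Lipschitz on `[a, b]` with constant `L`, with respect to the Hausdorff metric. -/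
def IsLip (a b L : ℝ) (F : ℝ → Set ℝ) : Prop :=
  ∀ x ∈ Set.Icc a b, ∀ y ∈ Set.Icc a b, Metric.hausdorffDist (F x) (F y) ≤ L * |x - y|

/-! ### Significant metric chains of the samples `S 0, …, S N` -/

section Chains

variable {N : ℕ} (S : Fin (N + 1) → Set ℝ)

/-- The approximated points of change of topology in the sample `S i`: midpoints of gaps of a
neighbouring sample that lie in `S i`. -/
def apct (i : Fin (N + 1)) : Set ℝ :=
  {p | ∃ j : Fin (N + 1), (j.val + 1 = i.val ∨ i.val + 1 = j.val) ∧
    (∃ q r : ℝ, IsGap (S j) q r ∧ p = (q + r) / 2) ∧ p ∈ S i ∧ p ∉ S j}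

/-- The right extended points of change of topology in the sample `S i`. -/
def extendedRight (i : Fin (N + 1)) : Set ℝ :=
  {p | p ∈ S i ∧ ∃ j, j < i ∧ p ∈ apct S j ∧ ∀ l, j < l → l < i → p ∈ S l}

/-- The left extended points of change of topology in the sample `S i`. -/
def extendedLeft (i : Fin (N + 1)) : Set ℝ :=
  {p | p ∈ S i ∧ ∃ j, i < j ∧ p ∈ apct S j ∧ ∀ l, i < l → l < j → p ∈ S l}

/-- The points of the sample `S i` which a significant metric chain may use. -/
def significantPoints (i : Fin (N + 1)) : Set ℝ :=
  discreteSample (S i) ∪ apct S i ∪ extendedRight S i ∪ extendedLeft S i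

/-- Significant metric chains: metric chains of the samples, all of whose pairs are also metric
pairs of the sets of significant points. -/
def IsSignificantChain (f : Fin (N + 1) → ℝ) : Prop :=
  IsMetricChain S f ∧ IsMetricChain (significantPoints S) f

end Chains

/-! ### The algorithm -/

/-- The value at `x` of the polynomial of degree at most `N` that interpolates the values `f i` at
the `N + 1` points `X i`. -/
def interp {N : ℕ} (X f : Fin (N + 1) → ℝ) (x : ℝ) : ℝ :=
  (Lagrange.interpolate Finset.univ X f).eval x

/-- Two chains `lo`, `hi` together with the indices `s`, `t` of the samples between which they are
used as the lower and the upper boundary of an approximated hole. -/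
structure ChainPair (N : ℕ) where
  s : Fin (N + 1)
  t : Fin (N + 1)
  lo : Fin (N + 1) → ℝ
  hi : Fin (N + 1) → ℝ

/-- `P` is an approximated hole of the samples `S`: two significant metric chains that follow, at
the samples strictly between the indices `s` and `t`, the lower and the upper end point of a gap of
the sample, and that meet at the indices `s` and `t`. They meet in the approximated
point of change of topology, the midpoint of the first (of the last) gap, whenever this midpoint
belongs to the sample `S s` (to `S t`). -/
structure IsApproxHole {N : ℕ} (S : Fin (N + 1) → Set ℝ) (P : ChainPair N) : Prop where
  lt : P.s.val + 1 < P.t.val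
  lo_chain : IsSignificantChain S P.lo
  hi_chain : IsSignificantChain S P.hi
  gap : ∀ i, P.s < i → i < P.t → IsGap (S i) (P.lo i) (P.hi i)
  meet_left : P.lo P.s = P.hi P.s
  meet_right : P.lo P.t = P.hi P.t
  apct_left : ∀ i : Fin (N + 1), P.s.val + 1 = i.val → (P.lo i + P.hi i) / 2 ∈ S P.s →
    P.lo P.s = (P.lo i + P.hi i) / 2
  apct_right : ∀ i : Fin (N + 1), i.val + 1 = P.t.val → (P.lo i + P.hi i) / 2 ∈ S P.t →
    P.lo P.t = (P.lo i + P.hi i) / 2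

/-- The hole over `[X s, X t]` whose boundary functions are the polynomials that interpolate the
two chains. -/
def ChainPair.toHoleData {N : ℕ} (P : ChainPair N) (X : Fin (N + 1) → ℝ) : HoleData where
  c := X P.s
  d := X P.t
  g := interp X P.lo
  h := interp X P.hi

/-- `G` is an output of the algorithm for the points `X` and the samples `S`. The algorithm chooses
approximated holes, one for each gap seen in the samples (a choice where several
chains fit), interpolates their chains, and the chains of the minima and of the maxima of the
samples, by polynomials, and builds `G` from these boundary functions. Only `X` and `S` enter. -/
def IsOutput {N : ℕ} (X : Fin (N + 1) → ℝ) (S : Fin (N + 1) → Set ℝ) (G : ℝ → Set ℝ) : Prop :=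
  ∃ (K : ℕ) (P : Fin K → ChainPair N),
    (∀ k, IsApproxHole S (P k)) ∧
    (∀ (i : Fin (N + 1)) (p q : ℝ), IsGap (S i) p q →
      ∃! k, (P k).s < i ∧ i < (P k).t ∧ (P k).lo i = p ∧ (P k).hi i = q) ∧
    ∀ x, G x = ofBoundaries (interp X fun i => sInf (S i)) (interp X fun i => sSup (S i))
      (fun k => (P k).toHoleData X) x

/-- The `N + 1` Chebyshev points of `[a, b]` in increasing order: the roots of the Chebyshev
polynomial of degree `N + 1`, transported from `[-1, 1]` to `[a, b]`. -/
def chebyshevPoint (a b : ℝ) (N : ℕ) (i : Fin (N + 1)) : ℝ :=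
  (a + b) / 2 - (b - a) / 2 * Real.cos ((2 * (i.val : ℝ) + 1) * Real.pi / (2 * ((N : ℝ) + 1)))

end

end SVF

/-!
Why the theorem is true.

**Convergence.** Consecutive members of a metric chain of the samples differ by at most the
Hausdorff distance of the two samples, so a chain satisfies a Lipschitz condition with the constant
`L` on the grid and extends to an `L`-Lipschitz function on the line. The polynomial interpolating an
`L`-Lipschitz function `f` at the Chebyshev points is `O(log N / N)`-close to it
(`abs_interp_chebyshev_sub_le`). This needs neither Jackson's theorem nor the Lebesgue constant: the
error at `x` is `O(1 / N)` times the alternating sum of the terms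
`sin θ_k * (f x_k - f x) / (x_k - x)`, consecutive terms differ by `O(1 / (|k - k₀| + 1))` when `x`
lies near the `k₀`-th node, and these bounds sum to `O(log N)`. The boundary functions of the holes
of `F` are `L`-Lipschitz as well (`HasSeparatedHoles.abs_boundary_sub_le`), and every gap of a sample
is the section of one hole of `F`. Hence each approximated hole over `x` is `O(log N / N)`-close to
a true hole, and each true hole over `x` is approximated by such a hole or has width `O(1 / N)`. As
the holes of `F` are a fixed distance apart, this bounds the Hausdorff distance of the values
(`HasSeparatedHoles.hausdorffDist_ofBoundaries_le`).

**Existence.** A metric pair of two samples that consists of significant points is automatically a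
metric pair of the sets of significant points (`IsMetricPair.mono`), and every significant point has
a partner among the significant points of each neighbouring sample (`exists_next_significant`). So
any partial chain of significant points extends to a significant chain. For a hole `j` the lower and
the upper end points of its gaps are followed as long as they form metric pairs. Where this fails, or
where the gaps of the hole begin or end, the two chains can be joined in one point, in the midpoint
of the gap if that belongs to the sample (`exists_meeting_point`). Cutting the gaps of each hole into
maximal sequences of this kind (`IsRun`) gives the approximated holes of an output. One hole may be
cut into several sequences when it is thin compared to the motion of its boundary.
-/

namespace SVF

/-! ### Interpolation at the Chebyshev points -/

open Polynomial Finset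

/-- The angle `θ_k` with `x_k = (a + b) / 2 - (b - a) / 2 * cos θ_k`. -/
noncomputable def chebyshevAngle (N k : ℕ) : ℝ :=
  (2 * (k : ℝ) + 1) * Real.pi / (2 * ((N : ℝ) + 1))

/-- The `k`-th Chebyshev point, indexed by the natural numbers. -/
noncomputable def chebyshevNode (a b : ℝ) (N k : ℕ) : ℝ :=
  (a + b) / 2 - (b - a) / 2 * Real.cos (chebyshevAngle N k)

theorem chebyshevPoint_eq (a b : ℝ) (N : ℕ) (i : Fin (N + 1)) :
    chebyshevPoint a b N i = chebyshevNode a b N i := rfl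

theorem succ_mul_chebyshevAngle (N k : ℕ) :
    ((N : ℝ) + 1) * chebyshevAngle N k = k * Real.pi + Real.pi / 2 := by
  have : (N : ℝ) + 1 ≠ 0 := by positivity
  unfold chebyshevAngle; field_simp

theorem chebyshevAngle_pos (N k : ℕ) : 0 < chebyshevAngle N k := by
  unfold chebyshevAngle; positivity

theorem chebyshevAngle_lt_pi {N k : ℕ} (hk : k ≤ N) : chebyshevAngle N k < Real.pi := by
  have hk' : (k : ℝ) ≤ N := by exact_mod_cast hk
  unfold chebyshevAngle
  rw [div_lt_iff₀ (by positivity)]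
  nlinarith [Real.pi_pos]

theorem chebyshevAngle_succ (N k : ℕ) :
    chebyshevAngle N (k + 1) = chebyshevAngle N k + Real.pi / ((N : ℝ) + 1) := by
  have : (N : ℝ) + 1 ≠ 0 := by positivity
  unfold chebyshevAngle; push_cast; field_simp; ring

theorem sin_chebyshevAngle_pos {N k : ℕ} (hk : k ≤ N) : 0 < Real.sin (chebyshevAngle N k) :=
  Real.sin_pos_of_pos_of_lt_pi (chebyshevAngle_pos N k) (chebyshevAngle_lt_pi hk)

theorem chebyshevAngle_strictMono (N : ℕ) : StrictMono (chebyshevAngle N) :=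
  strictMono_nat_of_lt_succ fun k => by
    rw [chebyshevAngle_succ]
    have := Real.pi_pos
    have : 0 < Real.pi / ((N : ℝ) + 1) := by positivity
    linarith

theorem chebyshevPoint_strictMono {a b : ℝ} (hab : a < b) (N : ℕ) :
    StrictMono (chebyshevPoint a b N) := by
  intro i j hij
  have h := Real.strictAntiOn_cos
    ⟨(chebyshevAngle_pos N i).le, (chebyshevAngle_lt_pi (Nat.lt_succ_iff.1 i.2)).le⟩
    ⟨(chebyshevAngle_pos N j).le, (chebyshevAngle_lt_pi (Nat.lt_succ_iff.1 j.2)).le⟩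
    (chebyshevAngle_strictMono N (Fin.lt_def.1 hij))
  rw [chebyshevPoint_eq, chebyshevPoint_eq, chebyshevNode, chebyshevNode]
  nlinarith

theorem chebyshevPoint_mem {a b : ℝ} (hab : a ≤ b) (N : ℕ) (i : Fin (N + 1)) :
    chebyshevPoint a b N i ∈ Set.Icc a b := by
  rw [chebyshevPoint_eq, chebyshevNode]
  constructor <;>
  nlinarith [Real.cos_le_one (chebyshevAngle N i), Real.neg_one_le_cos (chebyshevAngle N i)]

/-- The polynomial with the Chebyshev points as its roots is a multiple of the transported
Chebyshev polynomial. -/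
theorem exists_nodal_chebyshev {a b : ℝ} (hab : a < b) (N : ℕ) :
    ∃ c : ℝ, C c * Lagrange.nodal univ (chebyshevPoint a b N) =
      (Chebyshev.T ℝ ((N : ℤ) + 1)).comp (C ((a + b) / (b - a)) - C (2 / (b - a)) * X) := by
  have hba : b - a ≠ 0 := by linarith
  set P := (Chebyshev.T ℝ ((N : ℤ) + 1)).comp (C ((a + b) / (b - a)) - C (2 / (b - a)) * X)
    with hP
  have hlin : (C ((a + b) / (b - a)) - C (2 / (b - a)) * X : ℝ[X]).natDegree = 1 := by
    have : (C ((a + b) / (b - a)) - C (2 / (b - a)) * X : ℝ[X])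
      = C (-(2 / (b - a))) * X + C ((a + b) / (b - a)) := by simp; ring
    rw [this, natDegree_linear]
    simp [hba]
  have hdeg : P.natDegree = N + 1 := by
    rw [hP, natDegree_comp, hlin, Chebyshev.natDegree_T]
    simp; omega
  have hP0 : P ≠ 0 := by rintro h; simp [h] at hdeg
  have hl : P.leadingCoeff ≠ 0 := leadingCoeff_ne_zero.2 hP0
  refine ⟨P.leadingCoeff, ?_⟩
  have hmon := Lagrange.nodal_monic (s := univ) (v := chebyshevPoint a b N)
  have hdeg' : P.degree = ((N + 1 : ℕ) : WithBot ℕ) := by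
    rw [degree_eq_natDegree hP0, hdeg]
  have hd : (P - C P.leadingCoeff * Lagrange.nodal univ (chebyshevPoint a b N)).degree
      < P.degree := by
    apply degree_sub_lt_left
    · rw [degree_C_mul hl, Lagrange.degree_nodal, hdeg']; simp
    · exact hP0
    · rw [leadingCoeff_mul, hmon.leadingCoeff]; simp
  symm
  refine eq_of_degree_sub_lt_of_eval_index_eq (s := univ) (v := chebyshevPoint a b N)
    ((chebyshevPoint_strictMono hab N).injective.injOn) ?_ ?_
  · rw [hdeg'] at hd; simpa using hd
  · intro i _
    rw [eval_mul, Lagrange.eval_nodal_at_node (mem_univ i), mul_zero, hP, eval_comp]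
    have : eval (chebyshevPoint a b N i) (C ((a + b) / (b - a)) - C (2 / (b - a)) * X)
        = Real.cos (chebyshevAngle N i) := by
      rw [chebyshevPoint_eq, chebyshevNode]; simp; field_simp; ring
    rw [this, Chebyshev.T_real_cos]
    push_cast
    rw [succ_mul_chebyshevAngle, Real.cos_add_pi_div_two, Real.sin_nat_mul_pi, neg_zero]

/-- The coefficients of the barycentric formula at `x = (a + b) / 2 - (b - a) / 2 * cos φ`, from the
value and the derivative `n U_{n-1}` of the Chebyshev polynomial `T_n`, with `n = N + 1`. -/
theorem nodal_mul_nodalWeight_chebyshev {a b : ℝ} (hab : a < b) (N : ℕ) (φ : ℝ)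
    (i : Fin (N + 1)) :
    (Lagrange.nodal univ (chebyshevPoint a b N)).eval ((a + b) / 2 - (b - a) / 2 * Real.cos φ) *
      Lagrange.nodalWeight univ (chebyshevPoint a b N) i =
    -(Real.cos (((N : ℝ) + 1) * φ) * ((b - a) / 2 / ((N : ℝ) + 1)) *
      ((-1) ^ (i : ℕ) * Real.sin (chebyshevAngle N i))) := by
  obtain ⟨c, hc⟩ := exists_nodal_chebyshev hab N
  have hba : b - a ≠ 0 := by linarith
  have hN : (N : ℝ) + 1 ≠ 0 := by positivity
  set ω := Lagrange.nodal univ (chebyshevPoint a b N)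
  have hx : c * ω.eval ((a + b) / 2 - (b - a) / 2 * Real.cos φ)
      = Real.cos (((N : ℝ) + 1) * φ) := by
    have h := congrArg (eval ((a + b) / 2 - (b - a) / 2 * Real.cos φ)) hc
    rw [eval_mul, eval_C, eval_comp] at h
    rw [h]
    have : eval ((a + b) / 2 - (b - a) / 2 * Real.cos φ)
        (C ((a + b) / (b - a)) - C (2 / (b - a)) * X) = Real.cos φ := by
      simp; field_simp; ring
    rw [this, Chebyshev.T_real_cos]; push_cast; rfl
  have hD : c * (derivative ω).eval (chebyshevPoint a b N i) * Real.sin (chebyshevAngle N i)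
      = -(2 / (b - a)) * ((N : ℝ) + 1) * (-1) ^ (i : ℕ) := by
    have h := congrArg (fun p => eval (chebyshevPoint a b N i) (derivative p)) hc
    simp only [derivative_mul, derivative_C, zero_mul, zero_add, derivative_comp, eval_mul,
      eval_C, eval_comp] at h
    rw [h]
    have : eval (chebyshevPoint a b N i) (C ((a + b) / (b - a)) - C (2 / (b - a)) * X)
        = Real.cos (chebyshevAngle N i) := by
      rw [chebyshevPoint_eq, chebyshevNode]; simp; field_simp; ring
    rw [this, Chebyshev.T_derivative_eq_U]
    have hU := Chebyshev.U_real_cos (chebyshevAngle N i) (N : ℤ)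
    push_cast at hU
    rw [succ_mul_chebyshevAngle, Real.sin_add_pi_div_two, Real.cos_nat_mul_pi] at hU
    have : (N : ℤ) + 1 - 1 = N := by ring
    rw [this]
    simp
    linear_combination (2 / (b - a) * ((N : ℝ) + 1)) * hU
  rw [Lagrange.nodalWeight_eq_eval_derivative_nodal (mem_univ i)]
  have hD0 : (derivative ω).eval (chebyshevPoint a b N i) ≠ 0 := by
    intro h0
    rw [h0] at hD
    have : -(2 / (b - a)) * ((N : ℝ) + 1) * (-1) ^ (i : ℕ) ≠ 0 := by
      simp [hba, hN]
    exact this (by simpa using hD.symm)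
  rw [← hx, ← div_eq_mul_inv, div_eq_iff hD0]
  have e : ((-1 : ℝ) ^ (i : ℕ)) * (-1) ^ (i : ℕ) = 1 := by
    rw [← mul_pow]; simp
  set w := ω.eval ((a + b) / 2 - (b - a) / 2 * Real.cos φ)
  set σ := (-1 : ℝ) ^ (i : ℕ)
  set D := (derivative ω).eval (chebyshevPoint a b N i)
  calc w = w * (σ * σ) := by rw [e, mul_one]
    _ = -(w * ((b - a) / 2 / ((N : ℝ) + 1)) * σ * (-(2 / (b - a)) * ((N : ℝ) + 1) * σ)) := by
      field_simp
    _ = _ := by rw [← hD]; ring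

/-- The error of interpolation at the Chebyshev points is an alternating sum of divided
differences. -/
theorem interp_chebyshev_sub {a b : ℝ} (hab : a < b) (N : ℕ) (f : Fin (N + 1) → ℝ) (y φ : ℝ)
    (hne : ∀ i, (a + b) / 2 - (b - a) / 2 * Real.cos φ ≠ chebyshevPoint a b N i) :
    interp (chebyshevPoint a b N) f ((a + b) / 2 - (b - a) / 2 * Real.cos φ) - y =
      Real.cos (((N : ℝ) + 1) * φ) * ((b - a) / 2 / ((N : ℝ) + 1)) *
        ∑ i : Fin (N + 1), (-1) ^ (i : ℕ) * (Real.sin (chebyshevAngle N i) * ((f i - y) /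
          (chebyshevPoint a b N i - ((a + b) / 2 - (b - a) / 2 * Real.cos φ)))) := by
  set x := (a + b) / 2 - (b - a) / 2 * Real.cos φ with hx
  have hone := Lagrange.eval_interpolate_not_at_node (s := univ) (v := chebyshevPoint a b N)
    (x := x) 1 (fun i _ => hne i)
  rw [Lagrange.interpolate_one (chebyshevPoint_strictMono hab N).injective.injOn
    univ_nonempty, eval_one] at hone
  rw [interp, Lagrange.eval_interpolate_not_at_node _ (fun i _ => hne i)]
  have hy : y = ∑ i, (Lagrange.nodal univ (chebyshevPoint a b N)).eval x *
      (Lagrange.nodalWeight univ (chebyshevPoint a b N) i * (x - chebyshevPoint a b N i)⁻¹ * y) := by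
    simp only [Pi.one_apply, mul_one] at hone
    rw [← mul_sum, ← sum_mul, ← mul_assoc, ← hone, one_mul]
  conv_lhs => rw [hy]
  rw [mul_sum, mul_sum, ← sum_sub_distrib]
  refine sum_congr rfl fun i _ => ?_
  have hw := nodal_mul_nodalWeight_chebyshev hab N φ i
  rw [← hx] at hw
  have h1 : x - chebyshevPoint a b N i ≠ 0 := sub_ne_zero.2 (hne i)
  have h2 : chebyshevPoint a b N i - x ≠ 0 := sub_ne_zero.2 (hne i).symm
  have h3 : (x - chebyshevPoint a b N i)⁻¹ = -(chebyshevPoint a b N i - x)⁻¹ := by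
    rw [← neg_sub, inv_neg]
  rw [h3]
  linear_combination (-(chebyshevPoint a b N i - x)⁻¹ * (f i - y)) * hw

end SVF

namespace SVF

open Polynomial Finset

/-- Summation by parts for an alternating sum. -/
theorem two_mul_sum_alternating (b : ℕ → ℝ) (N : ℕ) :
    2 * ∑ k ∈ range (N + 1), (-1) ^ k * b k =
      b 0 + (-1) ^ N * b N + ∑ k ∈ range N, (-1) ^ k * (b k - b (k + 1)) := by
  induction N with
  | zero => simp; ring
  | succ N ih =>
    rw [sum_range_succ, mul_add, ih, sum_range_succ _ N]
    ring

theorem two_mul_abs_sum_alternating_le (b : ℕ → ℝ) (N : ℕ) :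
    2 * |∑ k ∈ range (N + 1), (-1) ^ k * b k| ≤
      |b 0| + |b N| + ∑ k ∈ range N, |b k - b (k + 1)| := by
  have h : 2 * |∑ k ∈ range (N + 1), (-1) ^ k * b k|
      = |2 * ∑ k ∈ range (N + 1), (-1) ^ k * b k| := by rw [abs_mul, abs_two]
  rw [h, two_mul_sum_alternating]
  refine (abs_add_le _ _).trans (add_le_add ((abs_add_le _ _).trans ?_) ?_)
  · simp [abs_mul]
  · refine (abs_sum_le_sum_abs _ _).trans (sum_le_sum fun k _ => ?_)
    simp [abs_mul]

theorem sum_inv_abs_sub_le {n k₀ : ℕ} (hk : k₀ ≤ n) :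
    ∑ k ∈ range n, 1 / (|(k : ℝ) - k₀| + 1) ≤ 2 * (1 + Real.log n) := by
  have hH : ∀ m ≤ n, ∑ k ∈ range m, 1 / ((k : ℝ) + 1) ≤ 1 + Real.log n := by
    intro m hm
    have h1 : ∑ k ∈ range m, 1 / ((k : ℝ) + 1) ≤ ∑ k ∈ range n, 1 / ((k : ℝ) + 1) :=
      sum_le_sum_of_subset_of_nonneg (range_subset_range.2 hm) fun k _ _ => by positivity
    have h2 := harmonic_le_one_add_log n
    simp only [harmonic] at h2
    push_cast at h2
    simp only [one_div]
    simp only [one_div] at h1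
    exact h1.trans h2
  have hl : ∑ k ∈ range k₀, 1 / (|(k : ℝ) - k₀| + 1) ≤ 1 + Real.log n := by
    refine le_trans ?_ (hH k₀ hk)
    rw [← sum_range_reflect]
    refine sum_le_sum fun k hk => ?_
    have hk' := mem_range.1 hk
    have : ((k₀ - 1 - k : ℕ) : ℝ) = k₀ - 1 - k := by
      rw [Nat.cast_sub (by omega), Nat.cast_sub (by omega)]; simp
    rw [this, abs_of_nonpos (by have : (0 : ℝ) ≤ k := by positivity
                                linarith)]
    apply one_div_le_one_div_of_le <;> linarith [(by positivity : (0 : ℝ) ≤ k)]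
  have hr : ∑ k ∈ Ico k₀ n, 1 / (|(k : ℝ) - k₀| + 1) ≤ 1 + Real.log n := by
    rw [sum_Ico_eq_sum_range]
    refine le_trans (le_of_eq (sum_congr rfl fun k _ => ?_)) (hH (n - k₀) (by omega))
    push_cast
    rw [add_sub_cancel_left, abs_of_nonneg (by positivity)]
  rw [← sum_range_add_sum_Ico _ hk]
  linarith

theorem chebyshevNode_succ_sub_le {a b : ℝ} (hab : a < b) (N k : ℕ) :
    |chebyshevNode a b N (k + 1) - chebyshevNode a b N k| ≤
      (b - a) / 2 * (Real.pi / ((N : ℝ) + 1)) := by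
  have h := Real.lipschitzWith_cos.dist_le_mul (chebyshevAngle N k) (chebyshevAngle N (k + 1))
  rw [Real.dist_eq, Real.dist_eq, chebyshevAngle_succ] at h
  have hpos : 0 ≤ Real.pi / ((N : ℝ) + 1) := by have := Real.pi_pos; positivity
  simp only [sub_add_cancel_left, NNReal.coe_one, one_mul, abs_neg, abs_of_nonneg hpos] at h
  have : chebyshevNode a b N (k + 1) - chebyshevNode a b N k = (b - a) / 2 *
      (Real.cos (chebyshevAngle N k) - Real.cos (chebyshevAngle N k + Real.pi / ((N : ℝ) + 1))) := by
    rw [chebyshevNode, chebyshevNode, chebyshevAngle_succ]; ring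
  rw [this, abs_mul, abs_of_pos (by linarith : 0 < (b - a) / 2)]
  exact mul_le_mul_of_nonneg_left h (by linarith)

/-- The distance of two points `m - r cos θ`, `m - r cos φ` is at least of the order
`r |φ - θ| sin θ`. -/
theorem sin_mul_abs_sub_le_cos_sub_cos {θ φ : ℝ} (hθ : θ ∈ Set.Icc 0 Real.pi)
    (hφ : φ ∈ Set.Icc 0 Real.pi) :
    Real.sin θ * |φ - θ| ≤ Real.pi * |Real.cos φ - Real.cos θ| := by
  have hs : Real.sin θ ≤ 2 * Real.sin ((φ + θ) / 2) := by
    have h1 : Real.sin θ + Real.sin φ =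
        2 * Real.sin ((φ + θ) / 2) * Real.cos ((φ - θ) / 2) := by
      rw [add_comm, Real.sin_add_sin]
    have h2 : 0 ≤ Real.sin φ := Real.sin_nonneg_of_mem_Icc hφ
    have h3 : 0 ≤ Real.sin ((φ + θ) / 2) :=
      Real.sin_nonneg_of_mem_Icc ⟨by linarith [hθ.1, hφ.1], by linarith [hθ.2, hφ.2]⟩
    nlinarith [Real.cos_le_one ((φ - θ) / 2)]
  have hd : |φ - θ| / Real.pi ≤ |Real.sin ((φ - θ) / 2)| := by
    have h := Real.mul_abs_le_abs_sin (x := (φ - θ) / 2) (by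
      rw [abs_le]; constructor <;> linarith [hθ.1, hφ.1, hθ.2, hφ.2])
    rw [abs_div, abs_two] at h
    refine le_trans (le_of_eq ?_) h
    field_simp
  rw [Real.cos_sub_cos, abs_mul, abs_mul, abs_neg, abs_two]
  have h0 : 0 ≤ Real.sin θ := Real.sin_nonneg_of_mem_Icc hθ
  have hπ := Real.pi_pos
  have hd' : |φ - θ| ≤ Real.pi * |Real.sin ((φ - θ) / 2)| := by
    rw [div_le_iff₀ hπ] at hd; linarith
  calc Real.sin θ * |φ - θ|
      ≤ (2 * |Real.sin ((φ + θ) / 2)|) * (Real.pi * |Real.sin ((φ - θ) / 2)|) :=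
        mul_le_mul (hs.trans (by linarith [le_abs_self (Real.sin ((φ + θ) / 2))])) hd'
          (abs_nonneg _) (by positivity)
    _ = _ := by ring

/-- For `u = x` the quotient is `0 / 0 = 0`. -/
theorem abs_divided_difference_le {L : ℝ} {f : ℝ → ℝ} (hL : 0 ≤ L)
    (hf : ∀ u v, |f u - f v| ≤ L * |u - v|) (u x : ℝ) : |(f u - f x) / (u - x)| ≤ L := by
  rw [abs_div]
  exact div_le_of_le_mul₀ (abs_nonneg _) hL (hf u x)

theorem abs_divided_difference_sub_le {L : ℝ} {f : ℝ → ℝ}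
    (hf : ∀ u v, |f u - f v| ≤ L * |u - v|) {u v x : ℝ} (hu : u ≠ x) (hv : v ≠ x) :
    |(f u - f x) / (u - x) - (f v - f x) / (v - x)| ≤ 2 * L * |u - v| / |u - x| := by
  have hu' : u - x ≠ 0 := sub_ne_zero.2 hu
  have hv' : v - x ≠ 0 := sub_ne_zero.2 hv
  have hL : 0 ≤ L := by
    have := (abs_nonneg _).trans (hf u x)
    exact nonneg_of_mul_nonneg_left this (abs_pos.2 hu')
  have e : (f u - f x) / (u - x) - (f v - f x) / (v - x) =
      ((f u - f v) + ((f v - f x) / (v - x)) * (v - u)) / (u - x) := by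
    field_simp; ring
  rw [e, abs_div]
  refine div_le_div_of_nonneg_right ?_ (abs_nonneg _)
  refine (abs_add_le _ _).trans ?_
  rw [abs_mul]
  have h1 := mul_le_mul_of_nonneg_right (abs_divided_difference_le hL hf v x) (abs_nonneg (v - u))
  rw [abs_sub_comm v u] at h1 ⊢
  linarith [hf u v]

/-- Consecutive terms of the alternating sum are close to each other away from the index `k₀` of
the interval in which the point `x = m - r cos φ` lies. -/
theorem abs_chebyshev_term_sub_le {a b L : ℝ} (hab : a < b) (hL : 0 ≤ L) {f : ℝ → ℝ}
    (hf : ∀ u v, |f u - f v| ≤ L * |u - v|) {N k k₀ : ℕ} (hk : k < N) {φ x : ℝ}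
    (hφ : φ ∈ Set.Icc 0 Real.pi) (hx : x = (a + b) / 2 - (b - a) / 2 * Real.cos φ)
    (h₀ : (k₀ : ℝ) ≤ ((N : ℝ) + 1) * φ / Real.pi)
    (h₁ : ((N : ℝ) + 1) * φ / Real.pi < k₀ + 1)
    (hne : ∀ j ≤ N, chebyshevNode a b N j ≠ x) :
    |Real.sin (chebyshevAngle N k) *
        ((f (chebyshevNode a b N k) - f x) / (chebyshevNode a b N k - x)) -
      Real.sin (chebyshevAngle N (k + 1)) *
        ((f (chebyshevNode a b N (k + 1)) - f x) / (chebyshevNode a b N (k + 1) - x))| ≤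
      L * (Real.pi / ((N : ℝ) + 1)) + 8 * Real.pi * L * (1 / (|(k : ℝ) - k₀| + 1)) := by
  set θ := chebyshevAngle N k with hθdef
  set q := (f (chebyshevNode a b N k) - f x) / (chebyshevNode a b N k - x) with hq
  set q' := (f (chebyshevNode a b N (k + 1)) - f x) / (chebyshevNode a b N (k + 1) - x) with hq'
  have hn : (0 : ℝ) < (N : ℝ) + 1 := by positivity
  have hπ := Real.pi_pos
  have hπ3 := Real.pi_gt_three
  have hqL : |q| ≤ L := abs_divided_difference_le hL hf _ _
  have hqL' : |q'| ≤ L := abs_divided_difference_le hL hf _ _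
  have hθ : θ ∈ Set.Icc 0 Real.pi := ⟨(chebyshevAngle_pos N k).le, (chebyshevAngle_lt_pi hk.le).le⟩
  have hsin0 : 0 < Real.sin θ := sin_chebyshevAngle_pos hk.le
  have hsin1 : Real.sin θ ≤ 1 := Real.sin_le_one θ
  have hss : |Real.sin θ - Real.sin (chebyshevAngle N (k + 1))| ≤ Real.pi / ((N : ℝ) + 1) := by
    refine (Real.abs_sin_sub_sin_le _ _).trans ?_
    rw [chebyshevAngle_succ, sub_add_cancel_left, abs_neg, abs_of_nonneg (by positivity)]
  have e : Real.sin θ * q - Real.sin (chebyshevAngle N (k + 1)) * q' =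
      (Real.sin θ - Real.sin (chebyshevAngle N (k + 1))) * q' + Real.sin θ * (q - q') := by ring
  rw [e]
  refine (abs_add_le _ _).trans (add_le_add ?_ ?_)
  · rw [abs_mul, mul_comm]
    exact mul_le_mul hqL' hss (abs_nonneg _) hL
  rw [abs_mul, abs_of_pos hsin0]
  -- for `k = k₀` the node may be arbitrarily close to `x`; there both quotients are at most `L`
  by_cases hkk : k = k₀
  · subst hkk
    simp only [sub_self, abs_zero, zero_add, div_one, mul_one]
    have h1 : |q - q'| ≤ 2 * L := (abs_sub _ _).trans (by linarith)
    have h2 : Real.sin θ * |q - q'| ≤ 1 * (2 * L) :=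
      mul_le_mul hsin1 h1 (abs_nonneg _) zero_le_one
    nlinarith
  -- the angular distance, in units of the mesh, is at least `|k - k₀| - 1 / 2`
  have hd1 : (1 : ℝ) ≤ |(k : ℝ) - k₀| := by
    have : (1 : ℤ) ≤ |(k : ℤ) - k₀| := Int.one_le_abs (by omega)
    exact_mod_cast this
  have hdist : Real.pi * ((|(k : ℝ) - k₀| + 1) / 4) ≤ ((N : ℝ) + 1) * |φ - θ| := by
    have hθn := succ_mul_chebyshevAngle N k
    rw [← hθdef] at hθn
    rw [le_div_iff₀ hπ] at h₀
    rw [div_lt_iff₀ hπ] at h₁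
    have e1 : ((N : ℝ) + 1) * |φ - θ| = |((N : ℝ) + 1) * φ - (k * Real.pi + Real.pi / 2)| := by
      rw [← hθn, ← mul_sub, abs_mul, abs_of_pos hn]
    rw [e1]
    rcases abs_cases ((k : ℝ) - k₀) with ⟨h, _⟩ | ⟨h, _⟩
    · rw [h] at hd1 ⊢
      refine le_trans ?_ (neg_le_abs _)
      nlinarith
    · rw [h] at hd1 ⊢
      refine le_trans ?_ (le_abs_self _)
      nlinarith
  have hφθ : 0 < |φ - θ| := by
    have : 0 < ((N : ℝ) + 1) * |φ - θ| := lt_of_lt_of_le (by positivity) hdist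
    exact pos_of_mul_pos_right this hn.le
  have hX : |chebyshevNode a b N k - x| = (b - a) / 2 * |Real.cos φ - Real.cos θ| := by
    rw [hx, chebyshevNode, ← hθdef]
    rw [← abs_of_pos (by linarith : 0 < (b - a) / 2), ← abs_mul,
      abs_of_pos (by linarith : 0 < (b - a) / 2)]
    congr 1; ring
  have hlow := sin_mul_abs_sub_le_cos_sub_cos hθ hφ
  have hXpos : 0 < |chebyshevNode a b N k - x| := abs_pos.2 (sub_ne_zero.2 (hne k hk.le))
  have hq2 := abs_divided_difference_sub_le hf (hne k hk.le) (hne (k + 1) hk)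
  have hmesh := chebyshevNode_succ_sub_le hab N k
  rw [abs_sub_comm] at hmesh
  -- the factor `sin θ_k` compensates the clustering of the nodes near `a` and `b`
  have h3 : Real.sin θ * ((b - a) / 2) ≤ Real.pi * |chebyshevNode a b N k - x| / |φ - θ| := by
    rw [le_div_iff₀ hφθ, hX]
    nlinarith [mul_le_mul_of_nonneg_left hlow (by linarith : 0 ≤ (b - a) / 2)]
  calc Real.sin θ * |q - q'|
      ≤ Real.sin θ * (2 * L * ((b - a) / 2 * (Real.pi / ((N : ℝ) + 1))) /
          |chebyshevNode a b N k - x|) := by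
        refine mul_le_mul_of_nonneg_left (hq2.trans ?_) hsin0.le
        gcongr
    _ = 2 * L * (Real.pi / ((N : ℝ) + 1)) * (Real.sin θ * ((b - a) / 2)) /
          |chebyshevNode a b N k - x| := by ring
    _ ≤ 2 * L * (Real.pi / ((N : ℝ) + 1)) *
          (Real.pi * |chebyshevNode a b N k - x| / |φ - θ|) / |chebyshevNode a b N k - x| := by
        gcongr
    _ = 2 * L * Real.pi * (Real.pi * (1 / (((N : ℝ) + 1) * |φ - θ|))) := by
        field_simp
    _ ≤ 2 * L * Real.pi * (Real.pi * (1 / (Real.pi * ((|(k : ℝ) - k₀| + 1) / 4)))) := by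
        gcongr
    _ = 8 * Real.pi * L * (1 / (|(k : ℝ) - k₀| + 1)) := by
        field_simp; ring

/-- **Interpolation of Lipschitz functions at the Chebyshev points**: the error is at most of the
order `log N / N`. -/
theorem abs_interp_chebyshev_sub_le {a b L : ℝ} (hab : a < b) (hL : 0 ≤ L) {f : ℝ → ℝ}
    (hf : ∀ u v, |f u - f v| ≤ L * |u - v|) (N : ℕ) {x : ℝ} (hx : x ∈ Set.Icc a b) :
    |interp (chebyshevPoint a b N) (fun i => f (chebyshevPoint a b N i)) x - f x| ≤
      20 * Real.pi * L * (b - a) * ((1 + Real.log ((N : ℝ) + 1)) / ((N : ℝ) + 1)) := by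
  have hπ := Real.pi_pos
  have hn : (0 : ℝ) < (N : ℝ) + 1 := by positivity
  have hlog : 0 ≤ Real.log ((N : ℝ) + 1) := Real.log_nonneg (by linarith [(by positivity : (0 : ℝ) ≤ N)])
  by_cases hnode : ∃ i, x = chebyshevPoint a b N i
  · obtain ⟨i, rfl⟩ := hnode
    rw [interp, Lagrange.eval_interpolate_at_node _
      (chebyshevPoint_strictMono hab N).injective.injOn (mem_univ i), sub_self, abs_zero]
    have : 0 ≤ b - a := by linarith
    positivity
  push Not at hnode
  set φ := Real.arccos (((a + b) / 2 - x) / ((b - a) / 2)) with hφdef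
  have hφ : φ ∈ Set.Icc 0 Real.pi := ⟨Real.arccos_nonneg _, Real.arccos_le_pi _⟩
  have hxφ : x = (a + b) / 2 - (b - a) / 2 * Real.cos φ := by
    have hba : (0 : ℝ) < (b - a) / 2 := by linarith
    rw [hφdef, Real.cos_arccos, mul_div_cancel₀ _ hba.ne']
    · ring
    · rw [le_div_iff₀ hba]; linarith [hx.2]
    · rw [div_le_iff₀ hba]; linarith [hx.1]
  have hne : ∀ j ≤ N, chebyshevNode a b N j ≠ x := fun j hj h =>
    hnode ⟨j, Nat.lt_succ_of_le hj⟩ (by rw [chebyshevPoint_eq]; exact h.symm)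
  set k₀ := ⌊((N : ℝ) + 1) * φ / Real.pi⌋₊ with hk₀
  have hτ0 : 0 ≤ ((N : ℝ) + 1) * φ / Real.pi := by have := hφ.1; positivity
  have h₀ : (k₀ : ℝ) ≤ ((N : ℝ) + 1) * φ / Real.pi := Nat.floor_le hτ0
  have h₁ : ((N : ℝ) + 1) * φ / Real.pi < k₀ + 1 := Nat.lt_floor_add_one _
  have hk₀N : k₀ ≤ N + 1 := by
    have : ((N : ℝ) + 1) * φ / Real.pi ≤ N + 1 := by
      rw [div_le_iff₀ hπ]; exact mul_le_mul_of_nonneg_left hφ.2 hn.le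
    exact_mod_cast h₀.trans this
  set t : ℕ → ℝ := fun k => Real.sin (chebyshevAngle N k) *
    ((f (chebyshevNode a b N k) - f x) / (chebyshevNode a b N k - x)) with ht
  have hsum := interp_chebyshev_sub hab N (fun i => f (chebyshevPoint a b N i)) (f x) φ
    (by rw [← hxφ]; exact hnode)
  rw [← hxφ] at hsum
  have hS : ∑ i : Fin (N + 1), (-1) ^ (i : ℕ) * (Real.sin (chebyshevAngle N i) *
      ((f (chebyshevPoint a b N i) - f x) / (chebyshevPoint a b N i - x))) =
      ∑ k ∈ range (N + 1), (-1) ^ k * t k :=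
    Fin.sum_univ_eq_sum_range (fun k => (-1) ^ k * t k) (N + 1)
  rw [hS] at hsum
  have htL : ∀ k, |t k| ≤ L := fun k => by
    rw [ht]; simp only [abs_mul]
    have := mul_le_mul (Real.abs_sin_le_one (chebyshevAngle N k))
      (abs_divided_difference_le hL hf (chebyshevNode a b N k) x) (abs_nonneg _) zero_le_one
    simpa using this
  have hA := two_mul_abs_sum_alternating_le t N
  have hB : ∑ k ∈ range N, |t k - t (k + 1)| ≤
      L * Real.pi + 8 * Real.pi * L * (2 * (1 + Real.log ((N : ℝ) + 1))) := by
    calc ∑ k ∈ range N, |t k - t (k + 1)|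
        ≤ ∑ k ∈ range N, (L * (Real.pi / ((N : ℝ) + 1)) +
            8 * Real.pi * L * (1 / (|(k : ℝ) - k₀| + 1))) :=
          sum_le_sum fun k hk => abs_chebyshev_term_sub_le hab hL hf (mem_range.1 hk) hφ hxφ
            h₀ h₁ hne
      _ ≤ ∑ k ∈ range (N + 1), (L * (Real.pi / ((N : ℝ) + 1)) +
            8 * Real.pi * L * (1 / (|(k : ℝ) - k₀| + 1))) :=
          sum_le_sum_of_subset_of_nonneg (range_subset_range.2 N.le_succ)
            fun k _ _ => by positivity
      _ = L * Real.pi + 8 * Real.pi * L *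
            ∑ k ∈ range (N + 1), (1 / (|(k : ℝ) - k₀| + 1)) := by
          rw [sum_add_distrib, sum_const, card_range, nsmul_eq_mul]
          push_cast
          congr 1
          · field_simp
          · rw [mul_sum]
      _ ≤ _ := by
          have := sum_inv_abs_sub_le hk₀N
          push_cast at this
          gcongr
  have hC : |∑ k ∈ range (N + 1), (-1) ^ k * t k| ≤ 20 * Real.pi * L *
      (1 + Real.log ((N : ℝ) + 1)) := by
    have h0 := htL 0
    have hN := htL N
    have hπ3 := Real.pi_gt_three
    have h4 : 0 ≤ Real.pi * L * Real.log ((N : ℝ) + 1) := by positivity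
    have h5 : 3 * L ≤ Real.pi * L := by gcongr
    nlinarith
  rw [hsum, abs_mul, abs_mul, abs_of_pos (by have : 0 < b - a := by linarith
                                             positivity : 0 < (b - a) / 2 / ((N : ℝ) + 1))]
  calc |Real.cos (((N : ℝ) + 1) * φ)| * ((b - a) / 2 / ((N : ℝ) + 1)) *
        |∑ k ∈ range (N + 1), (-1) ^ k * t k|
      ≤ 1 * ((b - a) / ((N : ℝ) + 1)) *
        (20 * Real.pi * L * (1 + Real.log ((N : ℝ) + 1))) := by
        have : 0 < b - a := by linarith
        gcongr
        · exact Real.abs_cos_le_one _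
        · linarith
    _ = _ := by ring

end SVF

namespace SVF

/-! ### Metric pairs at gaps and at end points -/

theorem IsMetricPair.symm {V W : Set ℝ} {v w : ℝ} (h : IsMetricPair V W v w) :
    IsMetricPair W V w v := by
  obtain ⟨hv, hw, h⟩ := h
  exact ⟨hw, hv, by rw [abs_sub_comm]; exact h.symm⟩

/-- A metric pair stays one when the two sets shrink and still contain it. -/
theorem IsMetricPair.mono {V W V' W' : Set ℝ} {v w : ℝ} (h : IsMetricPair V W v w)
    (hV : V' ⊆ V) (hW : W' ⊆ W) (hv : v ∈ V') (hw : w ∈ W') : IsMetricPair V' W' v w := by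
  refine ⟨hv, hw, h.2.2.imp (fun h => ?_) fun h => ?_⟩
  · refine le_antisymm (h.le.trans (Metric.infDist_le_infDist_of_subset hV ⟨v, hv⟩)) ?_
    simpa [Real.dist_eq, abs_sub_comm] using Metric.infDist_le_dist_of_mem (x := w) hv
  · refine le_antisymm (h.le.trans (Metric.infDist_le_infDist_of_subset hW ⟨w, hw⟩)) ?_
    simpa [Real.dist_eq] using Metric.infDist_le_dist_of_mem (x := v) hw

theorem infDist_eq_of_forall {S : Set ℝ} {y v : ℝ} (hv : v ∈ S)
    (h : ∀ z ∈ S, |y - v| ≤ |y - z|) : Metric.infDist y S = |y - v| := by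
  refine le_antisymm (Metric.infDist_le_dist_of_mem hv) ?_
  exact (Metric.le_infDist ⟨v, hv⟩).2 fun {z} hz => h z hz

theorem IsGap.le_or_le {S : Set ℝ} {p q z : ℝ} (h : IsGap S p q) (hz : z ∈ S) : z ≤ p ∨ q ≤ z := by
  by_contra! hc
  exact Set.disjoint_left.1 h.2.2.2 ⟨hc.1, hc.2⟩ hz

theorem IsGap.infDist_left {S : Set ℝ} {p q y : ℝ} (h : IsGap S p q) (hp : p ≤ y)
    (hy : y ≤ (p + q) / 2) : Metric.infDist y S = |y - p| := by
  refine infDist_eq_of_forall h.2.1 fun z hz => ?_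
  rw [abs_of_nonneg (sub_nonneg.2 hp)]
  rcases h.le_or_le hz with hz | hz
  · exact le_trans (by linarith) (le_abs_self _)
  · exact le_trans (by linarith) (neg_le_abs _)

theorem IsGap.infDist_right {S : Set ℝ} {p q y : ℝ} (h : IsGap S p q) (hq : y ≤ q)
    (hy : (p + q) / 2 ≤ y) : Metric.infDist y S = |y - q| := by
  refine infDist_eq_of_forall h.2.2.1 fun z hz => ?_
  rw [abs_of_nonpos (sub_nonpos.2 hq)]
  rcases h.le_or_le hz with hz | hz
  · exact le_trans (by linarith) (le_abs_self _)
  · exact le_trans (by linarith) (neg_le_abs _)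

theorem IsGap.mid_notMem {S : Set ℝ} {p q : ℝ} (h : IsGap S p q) : (p + q) / 2 ∉ S :=
  fun hm => Set.disjoint_left.1 h.2.2.2 ⟨by linarith [h.1], by linarith [h.1]⟩ hm

/-- The lower end point of a gap of `V` and a point of `W` in the lower half of the gap. -/
theorem IsGap.isMetricPair_left {V W : Set ℝ} {p q w : ℝ} (h : IsGap V p q) (hw : w ∈ W)
    (hp : p ≤ w) (hm : w ≤ (p + q) / 2) : IsMetricPair V W p w :=
  ⟨h.2.1, hw, Or.inl (by rw [h.infDist_left hp hm, abs_sub_comm])⟩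

/-- The upper end point of a gap of `V` and a point of `W` in the upper half of the gap. -/
theorem IsGap.isMetricPair_right {V W : Set ℝ} {p q w : ℝ} (h : IsGap V p q) (hw : w ∈ W)
    (hq : w ≤ q) (hm : (p + q) / 2 ≤ w) : IsMetricPair V W q w :=
  ⟨h.2.2.1, hw, Or.inl (by rw [h.infDist_right hq hm, abs_sub_comm])⟩

/-- Consider gaps `(p, q)` of `V` and `(p', q')` of `W`, such that `V` contains the part of
`[p', q']` outside of `(p, q)`. If the lower or the upper end points do not form a metric pair,
then both `p'` and `q'` form metric pairs with one point of `V`: with the midpoint of `(p', q')`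
if it belongs to `V`, and otherwise with `p` or with `q`. -/
theorem exists_meeting_point {V W : Set ℝ} {p q p' q' : ℝ} (h : IsGap V p q) (h' : IsGap W p' q')
    (hV : ∀ y ∈ Set.Icc p' q', y ∉ Set.Ioo p q → y ∈ V)
    (hn : ¬ (IsMetricPair V W p p' ∧ IsMetricPair V W q q')) :
    ∃ m ∈ V, IsMetricPair V W m p' ∧ IsMetricPair V W m q' ∧
      ((p' + q') / 2 ∈ V → m = (p' + q') / 2) ∧ (m = (p' + q') / 2 ∨ m = p ∨ m = q) := by
  have hpq := h.1
  have hpq' := h'.1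
  by_cases hm : (p' + q') / 2 ∈ V
  · exact ⟨_, hm, (h'.isMetricPair_left hm (by linarith) le_rfl).symm,
      (h'.isMetricPair_right hm (by linarith) le_rfl).symm, fun _ => rfl, Or.inl rfl⟩
  have hmid : (p' + q') / 2 ∈ Set.Ioo p q := by
    by_contra hc
    exact hm (hV _ ⟨by linarith, by linarith⟩ hc)
  -- `(p' + q') / 2` is removed from `V`, so it lies in `(p, q)`; a pair that is no metric pair then
  -- forces `p'` above, or `q'` below, the midpoint of `(p, q)`
  have hcase : ((p + q) / 2 < p' ∧ p < p') ∨ (q' < (p + q) / 2 ∧ q' < q) := by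
    by_contra! hc
    refine hn ⟨?_, ?_⟩
    · rcases le_total p' p with hle | hle
      · exact (h'.isMetricPair_left h.2.1 hle hmid.1.le).symm
      · refine h.isMetricPair_left h'.2.1 hle ?_
        by_contra! h3
        linarith [hc.1 h3]
    · rcases le_total q q' with hle | hle
      · exact (h'.isMetricPair_right h.2.2.1 hle hmid.2.le).symm
      · refine h.isMetricPair_right h'.2.2.1 hle ?_
        by_contra! h3
        linarith [hc.2 h3]
  rcases hcase with ⟨h1, h2⟩ | ⟨h1, h2⟩
  · refine ⟨q, h.2.2.1, ?_, ?_, fun hc => absurd hc hm, Or.inr (Or.inr rfl)⟩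
    · exact h.isMetricPair_right h'.2.1 (by linarith [hmid.2]) h1.le
    · rcases le_total q q' with hle | hle
      · exact (h'.isMetricPair_right h.2.2.1 hle hmid.2.le).symm
      · exact h.isMetricPair_right h'.2.2.1 hle (by linarith)
  · refine ⟨p, h.2.1, ?_, ?_, fun hc => absurd hc hm, Or.inr (Or.inl rfl)⟩
    · rcases le_total p p' with hle | hle
      · exact h.isMetricPair_left h'.2.1 hle (by linarith)
      · exact (h'.isMetricPair_left h.2.1 hle hmid.1.le).symm
    · exact h.isMetricPair_left h'.2.2.1 (by linarith [hmid.1]) h1.le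

/-! ### End points of maximal intervals -/

/-- The right end of the component of `v` in a compact set. -/
theorem exists_right_end {S : Set ℝ} (hS : IsCompact S) {v : ℝ} (hv : v ∈ S) :
    ∃ β, v ≤ β ∧ Set.Icc v β ⊆ S ∧ ∀ q, β < q → ¬ Set.Icc v q ⊆ S := by
  set A := {β | v ≤ β ∧ Set.Icc v β ⊆ S} with hA
  have hAS : A ⊆ S := fun β hβ => hβ.2 ⟨hβ.1, le_rfl⟩
  have hvA : v ∈ A := ⟨le_rfl, fun y hy => by rwa [le_antisymm hy.2 hy.1]⟩
  have hbdd : BddAbove A := hS.bddAbove.mono hAS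
  have hle : v ≤ sSup A := le_csSup hbdd hvA
  refine ⟨sSup A, hle, fun y hy => ?_, fun q hq hs => ?_⟩
  · rcases hy.2.lt_or_eq with h | h
    · obtain ⟨β, hβ, hyβ⟩ := exists_lt_of_lt_csSup ⟨v, hvA⟩ h
      exact hβ.2 ⟨hy.1, hyβ.le⟩
    · rw [h, ← hS.isClosed.closure_eq]
      exact closure_mono hAS (csSup_mem_closure ⟨v, hvA⟩ hbdd)
  · exact absurd (le_csSup hbdd (show q ∈ A from ⟨hle.trans hq.le, hs⟩)) (not_le.2 hq)

/-- The left end of the component of `v` in a compact set. -/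
theorem exists_left_end {S : Set ℝ} (hS : IsCompact S) {v : ℝ} (hv : v ∈ S) :
    ∃ α, α ≤ v ∧ Set.Icc α v ⊆ S ∧ ∀ p, p < α → ¬ Set.Icc p v ⊆ S := by
  set A := {α | α ≤ v ∧ Set.Icc α v ⊆ S} with hA
  have hAS : A ⊆ S := fun α hα => hα.2 ⟨le_rfl, hα.1⟩
  have hvA : v ∈ A := ⟨le_rfl, fun y hy => by rwa [le_antisymm hy.2 hy.1]⟩
  have hbdd : BddBelow A := hS.bddBelow.mono hAS
  have hle : sInf A ≤ v := csInf_le hbdd hvA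
  refine ⟨sInf A, hle, fun y hy => ?_, fun q hq hs => ?_⟩
  · rcases hy.1.lt_or_eq with h | h
    · obtain ⟨α, hα, hyα⟩ := exists_lt_of_csInf_lt ⟨v, hvA⟩ h
      exact hα.2 ⟨hyα.le, hy.2⟩
    · rw [← h, ← hS.isClosed.closure_eq]
      exact closure_mono hAS (csInf_mem_closure ⟨v, hvA⟩ hbdd)
  · exact absurd (csInf_le hbdd (show q ∈ A from ⟨hq.le.trans hle, hs⟩)) (not_le.2 hq)

theorem mem_discreteSample_of_right {S : Set ℝ} (hS : IsCompact S) {v : ℝ} (hv : v ∈ S)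
    (h : ∀ q, v < q → ¬ Set.Icc v q ⊆ S) : v ∈ discreteSample S := by
  obtain ⟨α, hα, hαS, hmax⟩ := exists_left_end hS hv
  refine ⟨α, v, ⟨hα, hαS, fun p' q' hp hq hs => ⟨?_, ?_⟩⟩, Or.inr rfl⟩
  · by_contra hne
    exact hmax p' (lt_of_le_of_ne hp hne) ((Set.Icc_subset_Icc_right hq).trans hs)
  · by_contra hne
    exact h q' (lt_of_le_of_ne hq (Ne.symm hne)) ((Set.Icc_subset_Icc_left (hp.trans hα)).trans hs)

theorem mem_discreteSample_of_left {S : Set ℝ} (hS : IsCompact S) {v : ℝ} (hv : v ∈ S)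
    (h : ∀ p, p < v → ¬ Set.Icc p v ⊆ S) : v ∈ discreteSample S := by
  obtain ⟨β, hβ, hβS, hmax⟩ := exists_right_end hS hv
  refine ⟨v, β, ⟨hβ, hβS, fun p' q' hp hq hs => ⟨?_, ?_⟩⟩, Or.inl rfl⟩
  · by_contra hne
    exact h p' (lt_of_le_of_ne hp hne) ((Set.Icc_subset_Icc_right (hβ.trans hq)).trans hs)
  · by_contra hne
    exact hmax q' (lt_of_le_of_ne hq (Ne.symm hne)) ((Set.Icc_subset_Icc_left hp).trans hs)

theorem IsGap.left_mem_discreteSample {S : Set ℝ} (hS : IsCompact S) {p q : ℝ}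
    (h : IsGap S p q) : p ∈ discreteSample S := by
  have hpq := h.1
  refine mem_discreteSample_of_right hS h.2.1 fun q' hq' hs => ?_
  have hmin : p < min q q' := lt_min h.1 hq'
  have h1 := min_le_left q q'
  have h2 := min_le_right q q'
  rcases h.le_or_le (z := (p + min q q') / 2) (hs ⟨by linarith, by linarith⟩) with h3 | h3 <;>
  linarith

theorem IsGap.right_mem_discreteSample {S : Set ℝ} (hS : IsCompact S) {p q : ℝ}
    (h : IsGap S p q) : q ∈ discreteSample S := by
  have hpq := h.1
  refine mem_discreteSample_of_left hS h.2.2.1 fun p' hp' hs => ?_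
  have hmax : max p p' < q := max_lt h.1 hp'
  have h1 := le_max_left p p'
  have h2 := le_max_right p p'
  rcases h.le_or_le (z := (q + max p p') / 2) (hs ⟨by linarith, by linarith⟩) with h3 | h3 <;>
  linarith

theorem discreteSample_subset (S : Set ℝ) : discreteSample S ⊆ S := by
  rintro y ⟨p, q, ⟨hpq, hs, -⟩, rfl | rfl⟩
  · exact hs ⟨le_rfl, hpq⟩
  · exact hs ⟨hpq, le_rfl⟩

theorem sSup_mem_discreteSample {S : Set ℝ} (hS : IsCompact S) (hne : S.Nonempty) :
    sSup S ∈ discreteSample S :=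
  mem_discreteSample_of_right hS (hS.sSup_mem hne) fun _ hq hs =>
    absurd (le_csSup hS.bddAbove (hs ⟨hq.le, le_rfl⟩)) (not_le.2 hq)

theorem sInf_mem_discreteSample {S : Set ℝ} (hS : IsCompact S) (hne : S.Nonempty) :
    sInf S ∈ discreteSample S :=
  mem_discreteSample_of_left hS (hS.sInf_mem hne) fun _ hq hs =>
    absurd (csInf_le hS.bddBelow (hs ⟨le_rfl, hq.le⟩)) (not_le.2 hq)

/-- The order structure of a finite disjoint union of compact intervals: a non-empty compact set,
each of whose points other than the maximum is followed by an interval of the set or by a gap,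
and symmetrically below. -/
structure IsFiniteUnionLike (S : Set ℝ) : Prop where
  isCompact : IsCompact S
  nonempty : S.Nonempty
  right : ∀ v ∈ S, v < sSup S → (∃ z, v < z ∧ Set.Icc v z ⊆ S) ∨ ∃ q, IsGap S v q
  left : ∀ v ∈ S, sInf S < v → (∃ z, z < v ∧ Set.Icc z v ⊆ S) ∨ ∃ p, IsGap S p v

/-- A point outside of `W` is closest to an end point of `W`. -/
theorem exists_nearest_mem_discreteSample {W : Set ℝ} (hW : IsCompact W) (hne : W.Nonempty)
    {v : ℝ} (hv : v ∉ W) : ∃ w ∈ discreteSample W, |v - w| = Metric.infDist v W := by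
  obtain ⟨w, hw, hd⟩ := hW.exists_infDist_eq_dist hne v
  rw [Real.dist_eq] at hd
  refine ⟨w, ?_, hd.symm⟩
  have hmin : ∀ z ∈ W, |v - w| ≤ |v - z| := fun z hz => by
    rw [← hd]; exact Metric.infDist_le_dist_of_mem hz
  have hvw : v ≠ w := fun h => hv (h ▸ hw)
  rcases lt_or_gt_of_ne hvw with h | h
  · refine mem_discreteSample_of_left hW hw fun p hp hs => ?_
    have hm : max p v < w := max_lt hp h
    have := hmin ((max p v + w) / 2) (hs ⟨by linarith [le_max_left p v], by linarith⟩)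
    rw [abs_of_neg (by linarith), abs_of_neg (by linarith [le_max_right p v])] at this
    linarith
  · refine mem_discreteSample_of_right hW hw fun p hp hs => ?_
    have hm : w < min p v := lt_min hp h
    have := hmin ((min p v + w) / 2) (hs ⟨by linarith, by linarith [min_le_left p v]⟩)
    rw [abs_of_pos (by linarith), abs_of_pos (by linarith [min_le_right p v])] at this
    linarith

/-- An end point `v` of `V` that lies in `W` forms a metric pair with an end point of `W` or with
the midpoint of a gap of `V`: from `v`, move away from `V` inside of `W`, at most to the midpoint of
the gap that begins at `v`. -/
theorem exists_isMetricPair_of_mem_discreteSample {V W : Set ℝ} (hV : IsFiniteUnionLike V)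
    (hW : IsFiniteUnionLike W) {v : ℝ} (hv : v ∈ discreteSample V) (hvW : v ∈ W) :
    ∃ w, IsMetricPair V W v w ∧
      (w ∈ discreteSample W ∨ ∃ q r, IsGap V q r ∧ w = (q + r) / 2) := by
  have hvV := discreteSample_subset V hv
  obtain ⟨p, q, ⟨hpq, hs, hmax⟩, rfl | rfl⟩ := hv
  · rcases (csInf_le hV.isCompact.bddBelow hvV).lt_or_eq with h | h
    · rcases hV.left _ hvV h with ⟨z, hz, hzs⟩ | ⟨r, hr⟩
      · exact absurd (hmax z q hz.le le_rfl (by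
          rw [← Set.Icc_union_Icc_eq_Icc hz.le hpq]; exact Set.union_subset hzs hs)).1 hz.ne
      · obtain ⟨β, hβ, hβs, hβm⟩ := exists_left_end hW.isCompact hvW
        have hrv := hr.1
        rcases le_or_gt β ((r + v) / 2) with hm | hm
        · exact ⟨_, hr.isMetricPair_right (hβs ⟨hm, by linarith⟩) (by linarith) le_rfl,
            Or.inr ⟨r, v, hr, rfl⟩⟩
        · refine ⟨β, hr.isMetricPair_right (hβs ⟨le_rfl, hβ⟩) hβ hm.le, Or.inl ?_⟩
          refine mem_discreteSample_of_left hW.isCompact (hβs ⟨le_rfl, hβ⟩) fun z hz hzs => ?_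
          exact hβm z hz (by
            rw [← Set.Icc_union_Icc_eq_Icc hz.le hβ]; exact Set.union_subset hzs hβs)
    · have hle := csInf_le hW.isCompact.bddBelow hvW
      refine ⟨sInf W, ⟨hvV, hW.isCompact.sInf_mem hW.nonempty, Or.inl ?_⟩,
        Or.inl (sInf_mem_discreteSample hW.isCompact hW.nonempty)⟩
      rw [infDist_eq_of_forall hvV, abs_sub_comm]
      intro z hz
      have := csInf_le hV.isCompact.bddBelow hz
      rw [abs_of_nonpos (by linarith), abs_of_nonpos (by linarith)]
      linarith
  · rcases (le_csSup hV.isCompact.bddAbove hvV).lt_or_eq with h | h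
    · rcases hV.right _ hvV h with ⟨z, hz, hzs⟩ | ⟨r, hr⟩
      · exact absurd (hmax p z le_rfl hz.le (by
          rw [← Set.Icc_union_Icc_eq_Icc hpq hz.le]; exact Set.union_subset hs hzs)).2 hz.ne'
      · obtain ⟨β, hβ, hβs, hβm⟩ := exists_right_end hW.isCompact hvW
        have hrv := hr.1
        rcases le_or_gt ((v + r) / 2) β with hm | hm
        · exact ⟨_, hr.isMetricPair_left (hβs ⟨by linarith, hm⟩) (by linarith) le_rfl,
            Or.inr ⟨v, r, hr, rfl⟩⟩
        · refine ⟨β, hr.isMetricPair_left (hβs ⟨hβ, le_rfl⟩) hβ hm.le, Or.inl ?_⟩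
          refine mem_discreteSample_of_right hW.isCompact (hβs ⟨hβ, le_rfl⟩) fun z hz hzs => ?_
          exact hβm z hz (by
            rw [← Set.Icc_union_Icc_eq_Icc hβ hz.le]; exact Set.union_subset hβs hzs)
    · have hle := le_csSup hW.isCompact.bddAbove hvW
      refine ⟨sSup W, ⟨hvV, hW.isCompact.sSup_mem hW.nonempty, Or.inl ?_⟩,
        Or.inl (sSup_mem_discreteSample hW.isCompact hW.nonempty)⟩
      rw [infDist_eq_of_forall hvV, abs_sub_comm]
      intro z hz
      have := le_csSup hV.isCompact.bddAbove hz
      rw [abs_of_nonneg (by linarith), abs_of_nonneg (by linarith)]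
      linarith

/-! ### Extension of partial chains to significant metric chains -/

section Chains

variable {N : ℕ} {S : Fin (N + 1) → Set ℝ}

theorem significantPoints_subset (i : Fin (N + 1)) : significantPoints S i ⊆ S i := by
  rintro p (((h | h) | h) | h)
  · exact discreteSample_subset _ h
  · obtain ⟨_, _, _, h, _⟩ := h; exact h
  · exact h.1
  · exact h.1

theorem discreteSample_subset_significantPoints (i : Fin (N + 1)) :
    discreteSample (S i) ⊆ significantPoints S i :=
  fun _ h => Or.inl (Or.inl (Or.inl h))

theorem IsGap.mid_mem_significantPoints {i j : Fin (N + 1)}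
    (hij : i.val + 1 = j.val ∨ j.val + 1 = i.val) {q r : ℝ} (h : IsGap (S i) q r)
    (hm : (q + r) / 2 ∈ S j) : (q + r) / 2 ∈ significantPoints S j :=
  Or.inl (Or.inl (Or.inr ⟨i, hij, ⟨q, r, h, rfl⟩, hm, h.mid_notMem⟩))

/-- A significant point of one sample that is not an end point stays significant in the
neighbouring samples that contain it. -/
theorem significantPoints_of_mem {i j : Fin (N + 1)}
    (hij : i.val + 1 = j.val ∨ j.val + 1 = i.val) {v : ℝ} (hv : v ∈ significantPoints S i)
    (hd : v ∉ discreteSample (S i)) (hvj : v ∈ S j) : v ∈ significantPoints S j := by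
  have hvi := significantPoints_subset i hv
  rcases hv with ((h | h) | ⟨_, k, hk, hka, hkl⟩) | ⟨_, k, hk, hka, hkl⟩
  · exact absurd h hd
  · rcases hij with hij | hij
    · exact Or.inl (Or.inr ⟨hvj, i, Fin.lt_def.2 (by omega), h, fun l h1 h2 => by
        rw [Fin.lt_def] at h1 h2; omega⟩)
    · exact Or.inr ⟨hvj, i, Fin.lt_def.2 (by omega), h, fun l h1 h2 => by
        rw [Fin.lt_def] at h1 h2; omega⟩
  · rw [Fin.lt_def] at hk
    by_cases hkj : k = j
    · subst hkj; exact Or.inl (Or.inl (Or.inr hka))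
    have hkj' : k.val ≠ j.val := fun h => hkj (Fin.ext h)
    refine Or.inl (Or.inr ⟨hvj, k, Fin.lt_def.2 (by omega), hka, fun l h1 h2 => ?_⟩)
    by_cases hli : l = i
    · rwa [hli]
    have hli' : l.val ≠ i.val := fun h => hli (Fin.ext h)
    rw [Fin.lt_def] at h2
    exact hkl l h1 (Fin.lt_def.2 (by omega))
  · rw [Fin.lt_def] at hk
    by_cases hkj : k = j
    · subst hkj; exact Or.inl (Or.inl (Or.inr hka))
    have hkj' : k.val ≠ j.val := fun h => hkj (Fin.ext h)
    refine Or.inr ⟨hvj, k, Fin.lt_def.2 (by omega), hka, fun l h1 h2 => ?_⟩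
    by_cases hli : l = i
    · rwa [hli]
    have hli' : l.val ≠ i.val := fun h => hli (Fin.ext h)
    rw [Fin.lt_def] at h1
    exact hkl l (Fin.lt_def.2 (by omega)) h2

/-- Each significant point of a sample forms a metric pair with a significant point of each
neighbouring sample. -/
theorem exists_next_significant (hS : ∀ i, IsFiniteUnionLike (S i)) {i j : Fin (N + 1)}
    (hij : i.val + 1 = j.val ∨ j.val + 1 = i.val) {v : ℝ} (hv : v ∈ significantPoints S i) :
    ∃ w ∈ significantPoints S j, IsMetricPair (S i) (S j) v w := by
  have hvi := significantPoints_subset i hv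
  by_cases hvj : v ∈ S j
  · by_cases hd : v ∈ discreteSample (S i)
    · obtain ⟨w, hw, h⟩ := exists_isMetricPair_of_mem_discreteSample (hS i) (hS j) hd hvj
      refine ⟨w, ?_, hw⟩
      rcases h with h | ⟨q, r, hg, rfl⟩
      · exact discreteSample_subset_significantPoints j h
      · exact hg.mid_mem_significantPoints hij hw.2.1
    · exact ⟨v, significantPoints_of_mem hij hv hd hvj, hvi, hvj,
        Or.inl (by rw [Metric.infDist_zero_of_mem hvi]; simp)⟩
  · obtain ⟨w, hw, h⟩ :=
      exists_nearest_mem_discreteSample (hS j).isCompact (hS j).nonempty hvj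
    exact ⟨w, discreteSample_subset_significantPoints j hw, hvi, discreteSample_subset _ hw,
      Or.inr h⟩

/-- `f` is a chain of significant points, for the samples with indices from `s` to `t`. -/
def IsPartialChain (S : Fin (N + 1) → Set ℝ) (s t : ℕ) (f : Fin (N + 1) → ℝ) : Prop :=
  (∀ i : Fin (N + 1), s ≤ i.val → i.val ≤ t → f i ∈ significantPoints S i) ∧
    ∀ i j : Fin (N + 1), i.val + 1 = j.val → s ≤ i.val → j.val ≤ t →
      IsMetricPair (S i) (S j) (f i) (f j)

theorem IsPartialChain.isSignificantChain {f : Fin (N + 1) → ℝ} (h : IsPartialChain S 0 N f) :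
    IsSignificantChain S f := by
  have h1 : ∀ i, f i ∈ significantPoints S i := fun i => h.1 i (Nat.zero_le _) (by omega)
  have h2 : ∀ i : Fin N, IsMetricPair (S i.castSucc) (S i.succ) (f i.castSucc) (f i.succ) :=
    fun i => h.2 _ _ (by simp) (Nat.zero_le _) (by simp)
  exact ⟨⟨fun i => significantPoints_subset i (h1 i), h2⟩, h1, fun i => (h2 i).mono
    (significantPoints_subset _) (significantPoints_subset _) (h1 _) (h1 _)⟩

theorem IsPartialChain.exists_extend_right (hS : ∀ i, IsFiniteUnionLike (S i)) {s t : ℕ}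
    {f : Fin (N + 1) → ℝ} (h : IsPartialChain S s t f) (hst : s ≤ t) (m : ℕ) (hm : t + m ≤ N) :
    ∃ f', IsPartialChain S s (t + m) f' ∧ ∀ i : Fin (N + 1), i.val ≤ t → f' i = f i := by
  induction m with
  | zero => exact ⟨f, h, fun _ _ => rfl⟩
  | succ m ih =>
    obtain ⟨f', hf', he⟩ := ih (by omega)
    let i₀ : Fin (N + 1) := ⟨t + m, by omega⟩
    let j₀ : Fin (N + 1) := ⟨t + m + 1, by omega⟩
    obtain ⟨w, hw, hpair⟩ := exists_next_significant hS (i := i₀) (j := j₀) (Or.inl rfl)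
      (hf'.1 i₀ (by simp [i₀]; omega) le_rfl)
    have hupd : ∀ i : Fin (N + 1), i.val ≤ t + m → Function.update f' j₀ w i = f' i := fun i hi =>
      Function.update_of_ne (fun h => by rw [h] at hi; simp [j₀] at hi) _ _
    refine ⟨Function.update f' j₀ w, ⟨fun i hs ht => ?_, fun i j hij hs ht => ?_⟩, fun i hi => ?_⟩
    · by_cases hi : i = j₀
      · subst hi; simpa using hw
      · have : i.val ≠ t + m + 1 := fun h => hi (Fin.ext h)
        rw [hupd i (by omega)]
        exact hf'.1 i hs (by omega)
    · by_cases hj : j = j₀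
      · subst hj
        have : i = i₀ := Fin.ext (by simp only [j₀] at hij; simp only [i₀]; omega)
        subst this
        rw [hupd _ le_rfl]; simpa using hpair
      · have : j.val ≠ t + m + 1 := fun h => hj (Fin.ext h)
        rw [hupd i (by omega), hupd j (by omega)]
        exact hf'.2 i j hij hs (by omega)
    · rw [hupd i (by omega), he i hi]

theorem IsPartialChain.exists_extend_left (hS : ∀ i, IsFiniteUnionLike (S i)) {s t : ℕ}
    {f : Fin (N + 1) → ℝ} (h : IsPartialChain S s t f) (hst : s ≤ t) (ht : t ≤ N) (m : ℕ)
    (hm : m ≤ s) :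
    ∃ f', IsPartialChain S (s - m) t f' ∧ ∀ i : Fin (N + 1), s ≤ i.val → f' i = f i := by
  induction m with
  | zero => exact ⟨f, h, fun _ _ => rfl⟩
  | succ m ih =>
    obtain ⟨f', hf', he⟩ := ih (by omega)
    let i₀ : Fin (N + 1) := ⟨s - m, by omega⟩
    let j₀ : Fin (N + 1) := ⟨s - (m + 1), by omega⟩
    have hij₀ : j₀.val + 1 = i₀.val := by simp [i₀, j₀]; omega
    obtain ⟨w, hw, hpair⟩ := exists_next_significant hS (i := i₀) (j := j₀) (Or.inr hij₀)
      (hf'.1 i₀ le_rfl (by simp [i₀]; omega))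
    have hupd : ∀ i : Fin (N + 1), s - m ≤ i.val → Function.update f' j₀ w i = f' i := fun i hi =>
      Function.update_of_ne (fun h => by rw [h] at hi; simp [j₀] at hi; omega) _ _
    refine ⟨Function.update f' j₀ w, ⟨fun i hs ht => ?_, fun i j hij hs ht => ?_⟩, fun i hi => ?_⟩
    · by_cases hi : i = j₀
      · subst hi; simpa using hw
      · have : i.val ≠ s - (m + 1) := fun h => hi (Fin.ext h)
        rw [hupd i (by omega)]
        exact hf'.1 i (by omega) ht
    · by_cases hi : i = j₀
      · subst hi
        have : j = i₀ := Fin.ext (by omega)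
        subst this
        rw [hupd i₀ le_rfl]; simpa using hpair.symm
      · have : i.val ≠ s - (m + 1) := fun h => hi (Fin.ext h)
        rw [hupd i (by omega), hupd j (by omega)]
        exact hf'.2 i j hij (by omega) ht
    · rw [hupd i (by omega), he i hi]

/-- A partial chain extends to a significant metric chain. -/
theorem IsPartialChain.exists_isSignificantChain (hS : ∀ i, IsFiniteUnionLike (S i)) {s t : ℕ}
    {f : Fin (N + 1) → ℝ} (h : IsPartialChain S s t f) (hst : s ≤ t) (ht : t ≤ N) :
    ∃ f', IsSignificantChain S f' ∧
      ∀ i : Fin (N + 1), s ≤ i.val → i.val ≤ t → f' i = f i := by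
  obtain ⟨f₁, h₁, e₁⟩ := h.exists_extend_right hS hst (N - t) (by omega)
  obtain ⟨f₂, h₂, e₂⟩ := h₁.exists_extend_left hS (by omega) (by omega) s le_rfl
  rw [Nat.sub_self, Nat.add_sub_cancel' ht] at h₂
  exact ⟨f₂, h₂.isSignificantChain, fun i hs ht => by rw [e₂ i hs, e₁ i ht]⟩

end Chains

end SVF

namespace SVF

open Filter Topology

/-! ### The holes of a Lipschitz set-valued function -/

/-- The hole together with its boundary curves and its two end points. -/
def HoleData.closedRegion (H : HoleData) : Set (ℝ × ℝ) :=
  {z | z.1 ∈ Set.Icc H.c H.d ∧ z.2 ∈ Set.Icc (H.g z.1) (H.h z.1)}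

section HasHoles

variable {a b : ℝ} {M : ℕ} {F : ℝ → Set ℝ} {H : Fin M → HoleData}

theorem HasHoles.g_le_h (hH : HasHoles a b F H) (j : Fin M) {x : ℝ}
    (hx : x ∈ Set.Icc (H j).c (H j).d) : (H j).g x ≤ (H j).h x := by
  rcases hx.1.eq_or_lt with h1 | h1
  · rw [← h1, hH.eq_left]
  rcases hx.2.eq_or_lt with h2 | h2
  · rw [h2, hH.eq_right]
  exact (hH.g_lt_h j x ⟨h1, h2⟩).le

theorem HasHoles.mem_Ioo_of_lt (hH : HasHoles a b F H) {j : Fin M} {x : ℝ}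
    (hx : x ∈ Set.Icc (H j).c (H j).d) (hlt : (H j).g x < (H j).h x) :
    x ∈ Set.Ioo (H j).c (H j).d := by
  refine ⟨lt_of_le_of_ne hx.1 ?_, lt_of_le_of_ne hx.2 ?_⟩
  · rintro rfl; exact hlt.ne (hH.eq_left j)
  · rintro rfl; exact hlt.ne (hH.eq_right j)

/-- The closed region is parametrized by `(x, t)`, with `t` the relative height in the section. -/
theorem HasHoles.closedRegion_eq_image (hH : HasHoles a b F H) (j : Fin M) :
    (H j).closedRegion = (fun z : ℝ × ℝ => (z.1, (H j).g z.1 + z.2 * ((H j).h z.1 - (H j).g z.1))) ''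
      (Set.Icc (H j).c (H j).d ×ˢ Set.Icc 0 1) := by
  ext ⟨x, y⟩
  constructor
  · rintro ⟨hx, hy⟩
    dsimp only at hx hy
    rcases (hH.g_le_h j hx).eq_or_lt with h | h
    · exact ⟨(x, 0), ⟨hx, by simp⟩, by simp; linarith [hy.1, hy.2]⟩
    · have h' : 0 < (H j).h x - (H j).g x := by linarith
      refine ⟨(x, (y - (H j).g x) / ((H j).h x - (H j).g x)), ⟨hx, ?_, ?_⟩, ?_⟩
      · exact div_nonneg (by linarith [hy.1]) h'.le
      · rw [div_le_one h']; linarith [hy.2]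
      · simp only [div_mul_cancel₀ _ h'.ne']; simp
  · rintro ⟨⟨u, t⟩, ⟨hu, ht⟩, he⟩
    simp only [Prod.mk.injEq] at he
    obtain ⟨rfl, rfl⟩ := he
    have := hH.g_le_h j hu
    have h0 : 0 ≤ (H j).h u - (H j).g u := by linarith
    exact ⟨hu, by nlinarith [ht.1], by nlinarith [ht.2]⟩

theorem HasHoles.continuousOn_param (hH : HasHoles a b F H) (j : Fin M) :
    ContinuousOn (fun z : ℝ × ℝ => (z.1, (H j).g z.1 + z.2 * ((H j).h z.1 - (H j).g z.1)))
      (Set.Icc (H j).c (H j).d ×ˢ Set.Icc (0 : ℝ) 1) := by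
  have hg : ContinuousOn (fun z : ℝ × ℝ => (H j).g z.1)
      (Set.Icc (H j).c (H j).d ×ˢ Set.Icc (0 : ℝ) 1) :=
    (hH.continuousOn_g j).comp continuousOn_fst fun z hz => hz.1
  have hh : ContinuousOn (fun z : ℝ × ℝ => (H j).h z.1)
      (Set.Icc (H j).c (H j).d ×ˢ Set.Icc (0 : ℝ) 1) :=
    (hH.continuousOn_h j).comp continuousOn_fst fun z hz => hz.1
  exact continuousOn_fst.prodMk (hg.add (continuousOn_snd.mul (hh.sub hg)))

theorem HasHoles.isCompact_closedRegion (hH : HasHoles a b F H) (j : Fin M) :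
    IsCompact (H j).closedRegion := by
  rw [hH.closedRegion_eq_image j]
  exact (isCompact_Icc.prod isCompact_Icc).image_of_continuousOn (hH.continuousOn_param j)

theorem HasHoles.closedRegion_subset (hH : HasHoles a b F H) (j : Fin M) :
    (H j).closedRegion ⊆ closure (H j).region := by
  have hcl : closure (Set.Ioo (H j).c (H j).d ×ˢ Set.Ioo (0 : ℝ) 1) =
      Set.Icc (H j).c (H j).d ×ˢ Set.Icc (0 : ℝ) 1 := by
    rw [closure_prod_eq, closure_Ioo (hH.lt j).ne, closure_Ioo zero_ne_one]
  have hc := hH.continuousOn_param j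
  rw [hH.closedRegion_eq_image j, ← hcl]
  rw [← hcl] at hc
  refine hc.image_closure.trans (closure_mono ?_)
  rintro _ ⟨⟨u, t⟩, ⟨hu, ht⟩, rfl⟩
  have := hH.g_lt_h j u hu
  exact ⟨hu, by nlinarith [ht.1], by nlinarith [ht.2]⟩

/-- By compactness there is a common lower bound for all distances that the holes have to keep. -/
theorem HasHoles.exists_separation (hH : HasHoles a b F H)
    (hl : ∀ j, ContinuousOn (lower F) (Set.Icc (H j).c (H j).d))
    (hu : ∀ j, ContinuousOn (upper F) (Set.Icc (H j).c (H j).d)) :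
    ∃ δ : ℝ, 0 < δ ∧ (∀ j, a + δ ≤ (H j).c) ∧ (∀ j, (H j).d + δ ≤ b) ∧
      (∀ j, ∀ x ∈ Set.Icc (H j).c (H j).d, lower F x + δ ≤ (H j).g x) ∧
      (∀ j, ∀ x ∈ Set.Icc (H j).c (H j).d, (H j).h x + δ ≤ upper F x) ∧
      ∀ j k, j ≠ k → ∀ z ∈ (H j).closedRegion, ∀ w ∈ (H k).closedRegion, δ ≤ dist z w := by
  have small : ∀ η : ℝ, 0 < η → ∀ᶠ δ in 𝓝[>] (0 : ℝ), δ ≤ η := fun η hη =>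
    eventually_of_mem (Ioo_mem_nhdsGT hη) fun δ hδ => hδ.2.le
  have e1 : ∀ᶠ δ in 𝓝[>] (0 : ℝ), ∀ j, a + δ ≤ (H j).c := eventually_all.2 fun j =>
    (small _ (sub_pos.2 (hH.left_lt j))).mono fun δ h => by linarith
  have e2 : ∀ᶠ δ in 𝓝[>] (0 : ℝ), ∀ j, (H j).d + δ ≤ b := eventually_all.2 fun j =>
    (small _ (sub_pos.2 (hH.lt_right j))).mono fun δ h => by linarith
  have e3 : ∀ᶠ δ in 𝓝[>] (0 : ℝ), ∀ j, ∀ x ∈ Set.Icc (H j).c (H j).d,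
      lower F x + δ ≤ (H j).g x := eventually_all.2 fun j => by
    obtain ⟨x₀, hx₀, hmin⟩ := isCompact_Icc.exists_isMinOn (Set.nonempty_Icc.2 (hH.lt j).le)
      ((hH.continuousOn_g j).sub (hl j))
    refine (small _ (sub_pos.2 (hH.lower_lt j x₀ hx₀))).mono fun δ h x hx => ?_
    have := hmin hx
    simp only [Set.mem_ofPred_eq, Pi.sub_apply] at this
    linarith
  have e4 : ∀ᶠ δ in 𝓝[>] (0 : ℝ), ∀ j, ∀ x ∈ Set.Icc (H j).c (H j).d,
      (H j).h x + δ ≤ upper F x := eventually_all.2 fun j => by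
    obtain ⟨x₀, hx₀, hmin⟩ := isCompact_Icc.exists_isMinOn (Set.nonempty_Icc.2 (hH.lt j).le)
      ((hu j).sub (hH.continuousOn_h j))
    refine (small _ (sub_pos.2 (hH.lt_upper j x₀ hx₀))).mono fun δ h x hx => ?_
    have := hmin hx
    simp only [Set.mem_ofPred_eq, Pi.sub_apply] at this
    linarith
  have e5 : ∀ᶠ δ in 𝓝[>] (0 : ℝ), ∀ j k, j ≠ k → ∀ z ∈ (H j).closedRegion,
      ∀ w ∈ (H k).closedRegion, δ ≤ dist z w :=
    eventually_all.2 fun j => eventually_all.2 fun k => by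
      by_cases hjk : j = k
      · exact Eventually.of_forall fun δ h => absurd hjk h
      have hd : Disjoint (H j).closedRegion (H k).closedRegion :=
        (hH.separated j k hjk).mono (hH.closedRegion_subset j) (hH.closedRegion_subset k)
      obtain ⟨η, hη, hη'⟩ := hd.exists_thickenings (hH.isCompact_closedRegion j)
        (hH.isCompact_closedRegion k).isClosed
      refine (small η hη).mono fun δ hδ _ z hz w hw => ?_
      by_contra! hlt
      exact Set.disjoint_left.1 hη' (Metric.self_subset_thickening hη _ hz)
        (Metric.mem_thickening_iff.2 ⟨w, hw, hlt.trans_le hδ⟩)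
  obtain ⟨δ, h1, h2, h3, h4, h5, hδ⟩ :=
    (e1.and (e2.and (e3.and (e4.and (e5.and self_mem_nhdsWithin))))).exists
  exact ⟨δ, hδ, h1, h2, h3, h4, h5⟩

end HasHoles

/-- A continuous function that is `L`-Lipschitz in a neighbourhood of each interior point of an
interval, the point itself being kept fixed, is `L`-Lipschitz on the interval. -/
theorem abs_sub_le_of_eventually {f : ℝ → ℝ} {c d L : ℝ} (hcd : c < d) (hL : 0 ≤ L)
    (hf : ContinuousOn f (Set.Icc c d))
    (hloc : ∀ x ∈ Set.Ioo c d, ∀ᶠ y in 𝓝 x, |f x - f y| ≤ L * |x - y|) :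
    ∀ x ∈ Set.Icc c d, ∀ y ∈ Set.Icc c d, |f x - f y| ≤ L * |x - y| := by
  have key : ∀ u ∈ Set.Ioo c d, ∀ v ∈ Set.Ioo c d, u ≤ v → |f u - f v| ≤ L * |u - v| := by
    intro u hu v hv huv
    have hsub : Set.Icc u v ⊆ Set.Ioo c d := fun t ht => ⟨hu.1.trans_le ht.1, ht.2.trans_lt hv.2⟩
    have hcont : ContinuousOn f (Set.Icc u v) := hf.mono (hsub.trans Set.Ioo_subset_Icc_self)
    set s := {t | |f u - f t| ≤ L * (t - u)} with hs
    have hclosed : IsClosed (s ∩ Set.Icc u v) := by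
      have : s ∩ Set.Icc u v = {t ∈ Set.Icc u v | |f u - f t| ≤ L * (t - u)} := by
        ext t; simp [hs, and_comm]
      rw [this]
      exact isClosed_Icc.isClosed_le (continuousOn_const.sub hcont).abs (by fun_prop)
    have hall : Set.Icc u v ⊆ s := by
      refine hclosed.Icc_subset_of_forall_exists_gt (by simp [hs]) ?_
      rintro t ⟨hts, htu⟩ y hy
      have h1 : ∀ᶠ z in 𝓝[>] t, |f t - f z| ≤ L * |t - z| :=
        (hloc t (hsub ⟨htu.1, htu.2.le⟩)).filter_mono nhdsWithin_le_nhds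
      obtain ⟨z, hz1, hz2⟩ := (h1.and (Ioc_mem_nhdsGT hy)).exists
      refine ⟨z, ?_, hz2⟩
      rw [abs_sub_comm t z, abs_of_pos (sub_pos.2 hz2.1)] at hz1
      have h2 := abs_sub_le (f u) (f t) (f z)
      simp only [hs, Set.mem_ofPred_eq] at hts ⊢
      linarith
    have := hall ⟨huv, le_rfl⟩
    rwa [abs_sub_comm u v, abs_of_nonneg (sub_nonneg.2 huv)]
  have hlip : LipschitzOnWith L.toNNReal f (Set.Ioo c d) := by
    refine LipschitzOnWith.of_dist_le_mul fun u hu v hv => ?_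
    rw [Real.dist_eq, Real.dist_eq, Real.coe_toNNReal _ hL]
    rcases le_total u v with h | h
    · exact key u hu v hv h
    · rw [abs_sub_comm, abs_sub_comm u]; exact key v hv u hu h
  have hlip' : LipschitzOnWith L.toNNReal f (Set.Icc c d) := by
    rw [← closure_Ioo hcd.ne] at hf ⊢
    exact hlip.closure hf
  intro x hx y hy
  have := hlip'.dist_le_mul x hx y hy
  rwa [Real.dist_eq, Real.dist_eq, Real.coe_toNNReal _ hL] at this

section Lipschitz

variable {a b L : ℝ} {F : ℝ → Set ℝ}

theorem IsLip.nonneg (hLip : IsLip a b L F) (hab : a < b) : 0 ≤ L := by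
  have h := Metric.hausdorffDist_nonneg.trans
    (hLip a (Set.left_mem_Icc.2 hab.le) b (Set.right_mem_Icc.2 hab.le))
  exact nonneg_of_mul_nonneg_left h (abs_pos.2 (sub_neg.2 hab).ne)

theorem IsLip.infDist_le (hLip : IsLip a b L F)
    (hF : ∀ x ∈ Set.Icc a b, (F x).Nonempty ∧ IsCompact (F x)) {x y v : ℝ}
    (hx : x ∈ Set.Icc a b) (hy : y ∈ Set.Icc a b) (hv : v ∈ F x) :
    Metric.infDist v (F y) ≤ L * |x - y| :=
  (Metric.infDist_le_hausdorffDist_of_mem hv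
    (Metric.hausdorffEDist_ne_top_of_nonempty_of_bounded (hF x hx).1 (hF y hy).1
      (hF x hx).2.isBounded (hF y hy).2.isBounded)).trans (hLip x hx y hy)

theorem IsLip.exists_near (hLip : IsLip a b L F)
    (hF : ∀ x ∈ Set.Icc a b, (F x).Nonempty ∧ IsCompact (F x)) {x y v : ℝ}
    (hx : x ∈ Set.Icc a b) (hy : y ∈ Set.Icc a b) (hv : v ∈ F x) :
    ∃ w ∈ F y, |v - w| ≤ L * |x - y| := by
  obtain ⟨w, hw, h⟩ := (hF y hy).2.exists_infDist_eq_dist (hF y hy).1 v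
  exact ⟨w, hw, by rw [← Real.dist_eq, ← h]; exact hLip.infDist_le hF hx hy hv⟩

theorem IsLip.abs_lower_sub_le (hLip : IsLip a b L F)
    (hF : ∀ x ∈ Set.Icc a b, (F x).Nonempty ∧ IsCompact (F x)) {x y : ℝ}
    (hx : x ∈ Set.Icc a b) (hy : y ∈ Set.Icc a b) :
    |lower F x - lower F y| ≤ L * |x - y| := by
  have key : ∀ {x y : ℝ}, x ∈ Set.Icc a b → y ∈ Set.Icc a b →
      lower F y - lower F x ≤ L * |x - y| := fun {x y} hx hy => by
    obtain ⟨w, hw, h⟩ := hLip.exists_near hF hx hy ((hF x hx).2.sInf_mem (hF x hx).1)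
    have h1 : lower F y ≤ w := csInf_le (hF y hy).2.bddBelow hw
    have h2 := (abs_le.1 h).1
    change lower F y - sInf (F x) ≤ _
    linarith
  rw [abs_le]
  have h1 := key hx hy
  have h2 := key hy hx
  rw [abs_sub_comm] at h2
  constructor <;> linarith

theorem IsLip.abs_upper_sub_le (hLip : IsLip a b L F)
    (hF : ∀ x ∈ Set.Icc a b, (F x).Nonempty ∧ IsCompact (F x)) {x y : ℝ}
    (hx : x ∈ Set.Icc a b) (hy : y ∈ Set.Icc a b) :
    |upper F x - upper F y| ≤ L * |x - y| := by
  have key : ∀ {x y : ℝ}, x ∈ Set.Icc a b → y ∈ Set.Icc a b →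
      upper F x - upper F y ≤ L * |x - y| := fun {x y} hx hy => by
    obtain ⟨w, hw, h⟩ := hLip.exists_near hF hx hy ((hF x hx).2.sSup_mem (hF x hx).1)
    have h1 : w ≤ upper F y := le_csSup (hF y hy).2.bddAbove hw
    have h2 := (abs_le.1 h).2
    change sSup (F x) - upper F y ≤ _
    linarith
  rw [abs_le]
  have h1 := key hx hy
  have h2 := key hy hx
  rw [abs_sub_comm] at h2
  constructor <;> linarith

theorem continuousOn_of_abs_sub_le {f : ℝ → ℝ} {s : Set ℝ} (hL : 0 ≤ L)
    (h : ∀ x ∈ s, ∀ y ∈ s, |f x - f y| ≤ L * |x - y|) : ContinuousOn f s :=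
  (LipschitzOnWith.of_dist_le_mul (K := L.toNNReal) fun x hx y hy => by
    rw [Real.dist_eq, Real.dist_eq, Real.coe_toNNReal _ hL]; exact h x hx y hy).continuousOn

/-- End points of close gaps of two values of a Lipschitz set-valued function. -/
theorem IsLip.abs_gap_sub_le (hLip : IsLip a b L F)
    (hF : ∀ x ∈ Set.Icc a b, (F x).Nonempty ∧ IsCompact (F x)) {x y p q p' q' : ℝ}
    (hx : x ∈ Set.Icc a b) (hy : y ∈ Set.Icc a b) (h : IsGap (F x) p q) (h' : IsGap (F y) p' q')
    (hp : |p - p'| < (q - p) / 4) (hq : |q - q'| < (q - p) / 4) :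
    |p - p'| ≤ L * |x - y| ∧ |q - q'| ≤ L * |x - y| := by
  obtain ⟨hp1, hp2⟩ := abs_lt.1 hp
  obtain ⟨hq1, hq2⟩ := abs_lt.1 hq
  constructor
  · rcases le_total p p' with hle | hle
    · have := hLip.infDist_le hF hy hx h'.2.1
      rw [h.infDist_left hle (by linarith)] at this
      rwa [abs_sub_comm p, abs_sub_comm x]
    · have := hLip.infDist_le hF hx hy h.2.1
      rwa [h'.infDist_left hle (by linarith)] at this
  · rcases le_total q q' with hle | hle
    · have := hLip.infDist_le hF hx hy h.2.2.1
      rwa [h'.infDist_right hle (by linarith)] at this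
    · have := hLip.infDist_le hF hy hx h'.2.2.1
      rw [h.infDist_right hle (by linarith)] at this
      rwa [abs_sub_comm q, abs_sub_comm x]

end Lipschitz

/-- A Lipschitz set-valued function with holes that keep the distance `δ` from each other, from the
lower and the upper boundary, and from the end points of the interval. -/
structure HasSeparatedHoles (a b L δ : ℝ) {M : ℕ} (F : ℝ → Set ℝ) (H : Fin M → HoleData) :
    Prop where
  lt : a < b
  pos : 0 < δ
  isLip : IsLip a b L F
  values : ∀ x ∈ Set.Icc a b, (F x).Nonempty ∧ IsCompact (F x)
  hasHoles : HasHoles a b F H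
  left_le : ∀ j, a + δ ≤ (H j).c
  le_right : ∀ j, (H j).d + δ ≤ b
  lower_le : ∀ j, ∀ x ∈ Set.Icc (H j).c (H j).d, lower F x + δ ≤ (H j).g x
  le_upper : ∀ j, ∀ x ∈ Set.Icc (H j).c (H j).d, (H j).h x + δ ≤ upper F x
  le_dist : ∀ j k, j ≠ k → ∀ z ∈ (H j).closedRegion, ∀ w ∈ (H k).closedRegion, δ ≤ dist z w

theorem MemClass.exists_hasSeparatedHoles {a b L : ℝ} (hab : a < b) {M : ℕ} {F : ℝ → Set ℝ}
    (hLip : IsLip a b L F) (hF : MemClass a b M F) :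
    ∃ (δ : ℝ) (H : Fin M → HoleData), HasSeparatedHoles a b L δ F H := by
  obtain ⟨hv, -, -, H, hH⟩ := hF
  have hsub : ∀ j, Set.Icc (H j).c (H j).d ⊆ Set.Icc a b := fun j =>
    Set.Icc_subset_Icc (hH.left_lt j).le (hH.lt_right j).le
  obtain ⟨δ, h0, h1, h2, h3, h4, h5⟩ := hH.exists_separation
    (fun j => continuousOn_of_abs_sub_le (hLip.nonneg hab) fun x hx y hy =>
      hLip.abs_lower_sub_le hv (hsub j hx) (hsub j hy))
    (fun j => continuousOn_of_abs_sub_le (hLip.nonneg hab) fun x hx y hy =>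
      hLip.abs_upper_sub_le hv (hsub j hx) (hsub j hy))
  exact ⟨δ, H, hab, h0, hLip, hv, hH, h1, h2, h3, h4, h5⟩

namespace HasSeparatedHoles

variable {a b L δ : ℝ} {M : ℕ} {F : ℝ → Set ℝ} {H : Fin M → HoleData}

theorem Icc_subset (h : HasSeparatedHoles a b L δ F H) (j : Fin M) :
    Set.Icc (H j).c (H j).d ⊆ Set.Icc a b :=
  Set.Icc_subset_Icc (h.hasHoles.left_lt j).le (h.hasHoles.lt_right j).le

theorem L_nonneg (h : HasSeparatedHoles a b L δ F H) : 0 ≤ L := h.isLip.nonneg h.lt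

theorem lower_le_upper (h : HasSeparatedHoles a b L δ F H) {x : ℝ} (hx : x ∈ Set.Icc a b) :
    lower F x ≤ upper F x :=
  csInf_le_csSup (h.values x hx).1 (h.values x hx).2.bddBelow (h.values x hx).2.bddAbove

theorem mem_iff (h : HasSeparatedHoles a b L δ F H) {x y : ℝ} (hx : x ∈ Set.Icc a b) :
    y ∈ F x ↔ y ∈ Set.Icc (lower F x) (upper F x) ∧
      ∀ j, x ∈ Set.Icc (H j).c (H j).d → y ∉ Set.Ioo ((H j).g x) ((H j).h x) := by
  conv_lhs => rw [h.hasHoles.eq_ofBoundaries x hx]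
  rw [ofBoundaries, Set.uIcc_of_le (h.lower_le_upper hx)]
  simp only [Set.mem_sdiff, Set.mem_ofPred_eq, not_exists, not_and]

/-- Points of the closed regions that are close to each other belong to the same hole. -/
theorem eq_of_near (h : HasSeparatedHoles a b L δ F H) {j k : Fin M} {x x' y y' : ℝ}
    (hx : x ∈ Set.Icc (H j).c (H j).d) (hy : y ∈ Set.Icc ((H j).g x) ((H j).h x))
    (hx' : x' ∈ Set.Icc (H k).c (H k).d) (hy' : y' ∈ Set.Icc ((H k).g x') ((H k).h x'))
    (h1 : |x - x'| < δ) (h2 : |y - y'| < δ) : j = k := by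
  by_contra hne
  have := h.le_dist j k hne (x, y) ⟨hx, hy⟩ (x', y') ⟨hx', hy'⟩
  rw [Prod.dist_eq, Real.dist_eq, Real.dist_eq] at this
  exact absurd this (not_le.2 (max_lt h1 h2))

/-- A point of the closure of a hole lies in the values of `F` at the arguments close to it, unless
it is removed from these values by the same hole. -/
theorem mem_of_near (h : HasSeparatedHoles a b L δ F H) {j : Fin M} {x x' y : ℝ}
    (hx : x ∈ Set.Icc a b) (hx' : x' ∈ Set.Icc (H j).c (H j).d)
    (hy : y ∈ Set.Icc ((H j).g x') ((H j).h x')) (h1 : |x - x'| < δ) (h2 : L * |x - x'| < δ)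
    (hn : x ∈ Set.Icc (H j).c (H j).d → y ∉ Set.Ioo ((H j).g x) ((H j).h x)) : y ∈ F x := by
  have hl := abs_le.1 (h.isLip.abs_lower_sub_le h.values hx (h.Icc_subset j hx'))
  have hu := abs_le.1 (h.isLip.abs_upper_sub_le h.values hx (h.Icc_subset j hx'))
  refine (h.mem_iff hx).2 ⟨⟨?_, ?_⟩, fun k hk hyk => ?_⟩
  · linarith [h.lower_le j x' hx', hy.1]
  · linarith [h.le_upper j x' hx', hy.2]
  · have : j = k := h.eq_of_near hx' hy hk ⟨hyk.1.le, hyk.2.le⟩ (by rwa [abs_sub_comm])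
      (by simpa using h.pos)
    subst this
    exact hn hk hyk

theorem g_mem (h : HasSeparatedHoles a b L δ F H) {j : Fin M} {x : ℝ}
    (hx : x ∈ Set.Icc (H j).c (H j).d) : (H j).g x ∈ F x :=
  h.mem_of_near (h.Icc_subset j hx) hx ⟨le_rfl, h.hasHoles.g_le_h j hx⟩ (by simpa using h.pos)
    (by simpa using h.pos) fun _ hc => lt_irrefl _ hc.1

theorem h_mem (h : HasSeparatedHoles a b L δ F H) {j : Fin M} {x : ℝ}
    (hx : x ∈ Set.Icc (H j).c (H j).d) : (H j).h x ∈ F x :=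
  h.mem_of_near (h.Icc_subset j hx) hx ⟨h.hasHoles.g_le_h j hx, le_rfl⟩ (by simpa using h.pos)
    (by simpa using h.pos) fun _ hc => lt_irrefl _ hc.2

theorem isGap (h : HasSeparatedHoles a b L δ F H) {j : Fin M} {x : ℝ}
    (hx : x ∈ Set.Ioo (H j).c (H j).d) : IsGap (F x) ((H j).g x) ((H j).h x) := by
  have hx' := Set.Ioo_subset_Icc_self hx
  refine ⟨h.hasHoles.g_lt_h j x hx, h.g_mem hx', h.h_mem hx', Set.disjoint_left.2 fun y hy hF => ?_⟩
  exact ((h.mem_iff (h.Icc_subset j hx')).1 hF).2 j hx' hy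

/-- Every gap of a value of `F` is the section of a hole. -/
theorem exists_of_isGap (h : HasSeparatedHoles a b L δ F H) {x p q : ℝ} (hx : x ∈ Set.Icc a b)
    (hg : IsGap (F x) p q) :
    ∃ j, x ∈ Set.Ioo (H j).c (H j).d ∧ p = (H j).g x ∧ q = (H j).h x := by
  have hpq := hg.1
  have hp := (h.mem_iff hx).1 hg.2.1
  have hq := (h.mem_iff hx).1 hg.2.2.1
  have hm := fun hc => hg.mid_notMem ((h.mem_iff hx).2 hc)
  have : ∃ j, x ∈ Set.Icc (H j).c (H j).d ∧ (p + q) / 2 ∈ Set.Ioo ((H j).g x) ((H j).h x) := by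
    by_contra! hc
    exact hm ⟨⟨by linarith [hp.1.1], by linarith [hq.1.2]⟩, hc⟩
  obtain ⟨j, hxj, hj⟩ := this
  have hp' : p ≤ (H j).g x := by
    by_contra! hc
    exact hp.2 j hxj ⟨hc, by linarith [hj.2]⟩
  have hq' : (H j).h x ≤ q := by
    by_contra! hc
    exact hq.2 j hxj ⟨by linarith [hj.1], hc⟩
  refine ⟨j, h.hasHoles.mem_Ioo_of_lt hxj (hj.1.trans hj.2), le_antisymm hp' ?_, le_antisymm ?_ hq'⟩
  · rcases hg.le_or_le (h.g_mem hxj) with h1 | h1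
    · exact h1
    · linarith [hj.1]
  · rcases hg.le_or_le (h.h_mem hxj) with h1 | h1
    · linarith [hj.2]
    · exact h1

theorem hole_eq_of_g_eq (h : HasSeparatedHoles a b L δ F H) {j k : Fin M} {x : ℝ}
    (hj : x ∈ Set.Icc (H j).c (H j).d) (hk : x ∈ Set.Icc (H k).c (H k).d)
    (he : (H j).g x = (H k).g x) : j = k :=
  h.eq_of_near hj ⟨le_rfl, h.hasHoles.g_le_h j hj⟩ hk ⟨le_rfl, h.hasHoles.g_le_h k hk⟩
    (by simpa using h.pos) (by simpa [he] using h.pos)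

theorem isFiniteUnionLike (h : HasSeparatedHoles a b L δ F H) {x : ℝ} (hx : x ∈ Set.Icc a b) :
    IsFiniteUnionLike (F x) where
  isCompact := (h.values x hx).2
  nonempty := (h.values x hx).1
  right v hv hvu := by
    have hv' := (h.mem_iff hx).1 hv
    by_cases hgap : ∃ k, x ∈ Set.Ioo (H k).c (H k).d ∧ v = (H k).g x
    · obtain ⟨k, hk, rfl⟩ := hgap
      exact Or.inr ⟨_, h.isGap hk⟩
    left
    have hev : ∀ᶠ t in 𝓝[>] v, ∀ k, x ∈ Set.Icc (H k).c (H k).d →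
        t ∉ Set.Ioo ((H k).g x) ((H k).h x) := eventually_all.2 fun k => by
      by_cases hk : x ∈ Set.Icc (H k).c (H k).d
      swap
      · exact Eventually.of_forall fun _ hc => absurd hc hk
      rcases lt_trichotomy v ((H k).g x) with hlt | heq | hgt
      · exact eventually_of_mem (Ioo_mem_nhdsGT hlt) fun t ht _ hc => lt_asymm ht.2 hc.1
      · refine Eventually.of_forall fun t _ hc => hgap ⟨k, ?_, heq⟩
        exact h.hasHoles.mem_Ioo_of_lt hk (hc.1.trans hc.2)
      · refine eventually_nhdsWithin_of_forall fun t ht _ hc => hv'.2 k hk ⟨hgt, ?_⟩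
        exact lt_trans ht hc.2
    have hmem : ∀ᶠ t in 𝓝[>] v, t ∈ F x := by
      filter_upwards [hev, Ioo_mem_nhdsGT hvu] with t ht htu
      exact (h.mem_iff hx).2 ⟨⟨hv'.1.1.trans htu.1.le, htu.2.le⟩, ht⟩
    obtain ⟨z, hz, hzs⟩ := mem_nhdsGT_iff_exists_Ioc_subset.1 hmem
    refine ⟨z, hz, fun t ht => ?_⟩
    rcases ht.1.eq_or_lt with rfl | h'
    · exact hv
    · exact hzs ⟨h', ht.2⟩
  left v hv hvl := by
    have hv' := (h.mem_iff hx).1 hv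
    by_cases hgap : ∃ k, x ∈ Set.Ioo (H k).c (H k).d ∧ v = (H k).h x
    · obtain ⟨k, hk, rfl⟩ := hgap
      exact Or.inr ⟨_, h.isGap hk⟩
    left
    have hev : ∀ᶠ t in 𝓝[<] v, ∀ k, x ∈ Set.Icc (H k).c (H k).d →
        t ∉ Set.Ioo ((H k).g x) ((H k).h x) := eventually_all.2 fun k => by
      by_cases hk : x ∈ Set.Icc (H k).c (H k).d
      swap
      · exact Eventually.of_forall fun _ hc => absurd hc hk
      rcases lt_trichotomy ((H k).h x) v with hlt | heq | hgt
      · exact eventually_of_mem (Ioo_mem_nhdsLT hlt) fun t ht _ hc => lt_asymm ht.1 hc.2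
      · refine Eventually.of_forall fun t _ hc => hgap ⟨k, ?_, heq.symm⟩
        exact h.hasHoles.mem_Ioo_of_lt hk (hc.1.trans hc.2)
      · refine eventually_nhdsWithin_of_forall fun t ht _ hc => hv'.2 k hk ⟨?_, hgt⟩
        exact lt_trans hc.1 ht
    have hmem : ∀ᶠ t in 𝓝[<] v, t ∈ F x := by
      filter_upwards [hev, Ioo_mem_nhdsLT hvl] with t ht htu
      exact (h.mem_iff hx).2 ⟨⟨htu.1.le, htu.2.le.trans hv'.1.2⟩, ht⟩
    obtain ⟨z, hz, hzs⟩ := mem_nhdsLT_iff_exists_Ico_subset.1 hmem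
    refine ⟨z, hz, fun t ht => ?_⟩
    rcases ht.2.eq_or_lt with rfl | h'
    · exact hv
    · exact hzs ⟨ht.1, h'⟩

/-- The boundary functions of the holes are Lipschitz with the constant of `F`. -/
theorem abs_boundary_sub_le (h : HasSeparatedHoles a b L δ F H) (j : Fin M) :
    (∀ x ∈ Set.Icc (H j).c (H j).d, ∀ y ∈ Set.Icc (H j).c (H j).d,
      |(H j).g x - (H j).g y| ≤ L * |x - y|) ∧
    ∀ x ∈ Set.Icc (H j).c (H j).d, ∀ y ∈ Set.Icc (H j).c (H j).d,
      |(H j).h x - (H j).h y| ≤ L * |x - y| := by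
  have hloc : ∀ x ∈ Set.Ioo (H j).c (H j).d, ∀ᶠ y in 𝓝 x,
      |(H j).g x - (H j).g y| ≤ L * |x - y| ∧ |(H j).h x - (H j).h y| ≤ L * |x - y| := by
    intro x hx
    have hnhds : Set.Icc (H j).c (H j).d ∈ 𝓝 x := Icc_mem_nhds hx.1 hx.2
    have hw : 0 < ((H j).h x - (H j).g x) / 4 := by linarith [h.hasHoles.g_lt_h j x hx]
    have hg := ((h.hasHoles.continuousOn_g j).continuousAt hnhds).eventually
      (Metric.ball_mem_nhds _ hw)
    have hh := ((h.hasHoles.continuousOn_h j).continuousAt hnhds).eventually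
      (Metric.ball_mem_nhds _ hw)
    filter_upwards [hg, hh, Ioo_mem_nhds hx.1 hx.2] with y hyg hyh hy
    rw [dist_comm, Real.dist_eq] at hyg hyh
    exact h.isLip.abs_gap_sub_le h.values (h.Icc_subset j (Set.Ioo_subset_Icc_self hx))
      (h.Icc_subset j (Set.Ioo_subset_Icc_self hy)) (h.isGap hx) (h.isGap hy) hyg hyh
  exact ⟨abs_sub_le_of_eventually (h.hasHoles.lt j) h.L_nonneg (h.hasHoles.continuousOn_g j)
      fun x hx => (hloc x hx).mono fun _ => And.left,
    abs_sub_le_of_eventually (h.hasHoles.lt j) h.L_nonneg (h.hasHoles.continuousOn_h j)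
      fun x hx => (hloc x hx).mono fun _ => And.right⟩

end HasSeparatedHoles

end SVF

namespace SVF

/-! ### Existence of an output -/

/-- An increasing sequence of points of `[a, b]` that leaves no interval longer than `μ` free. -/
structure IsGrid (a b μ : ℝ) {N : ℕ} (X : Fin (N + 1) → ℝ) : Prop where
  mem : ∀ i, X i ∈ Set.Icc a b
  strictMono : StrictMono X
  step_le : ∀ i j : Fin (N + 1), i.val + 1 = j.val → X j - X i ≤ μ
  first_le : X 0 - a ≤ μ
  le_last : b - X (Fin.last N) ≤ μ

theorem IsGrid.abs_step_le {a b μ : ℝ} {N : ℕ} {X : Fin (N + 1) → ℝ} (hX : IsGrid a b μ X)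
    {i j : Fin (N + 1)} (hij : i.val + 1 = j.val ∨ j.val + 1 = i.val) : |X i - X j| ≤ μ := by
  rcases hij with h | h
  · have h1 := hX.strictMono (Fin.lt_def.2 (by omega : i.val < j.val))
    rw [abs_sub_comm, abs_of_pos (by linarith)]
    exact hX.step_le i j h
  · have h1 := hX.strictMono (Fin.lt_def.2 (by omega : j.val < i.val))
    rw [abs_of_pos (by linarith)]
    exact hX.step_le j i h

/-- A partial chain with prescribed values `φ` strictly between two indices extends to a
significant metric chain with prescribed values at these two indices. -/
theorem exists_isSignificantChain_between {N : ℕ} {S : Fin (N + 1) → Set ℝ}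
    (hS : ∀ i, IsFiniteUnionLike (S i)) {s t : Fin (N + 1)} (hst : s.val + 1 < t.val)
    {φ : Fin (N + 1) → ℝ} {ms mt : ℝ}
    (hms : ms ∈ significantPoints S s) (hmt : mt ∈ significantPoints S t)
    (hφ : ∀ i, s < i → i < t → φ i ∈ significantPoints S i)
    (hpair : ∀ i j : Fin (N + 1), i.val + 1 = j.val → s < i → j < t →
      IsMetricPair (S i) (S j) (φ i) (φ j))
    (hs : ∀ i : Fin (N + 1), s.val + 1 = i.val → IsMetricPair (S s) (S i) ms (φ i))
    (ht : ∀ i : Fin (N + 1), i.val + 1 = t.val → IsMetricPair (S t) (S i) mt (φ i)) :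
    ∃ f, IsSignificantChain S f ∧ f s = ms ∧ f t = mt ∧ ∀ i, s < i → i < t → f i = φ i := by
  have hts : t ≠ s := fun h => by rw [h] at hst; omega
  set f₀ : Fin (N + 1) → ℝ := fun i => if i = s then ms else if i = t then mt else φ i with hf₀
  have fs : f₀ s = ms := by simp [hf₀]
  have ft : f₀ t = mt := by simp [hf₀, hts]
  have fi : ∀ i, s < i → i < t → f₀ i = φ i := fun i h1 h2 => by
    simp [hf₀, h1.ne', h2.ne]
  have hpartial : IsPartialChain S s t f₀ := by
    refine ⟨fun i h1 h2 => ?_, fun i j hij h1 h2 => ?_⟩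
    · rcases (Fin.le_def.2 h1).eq_or_lt with h1 | h1
      · rw [← h1, fs]; exact hms
      rcases (Fin.le_def.2 h2).eq_or_lt with h2 | h2
      · rw [h2, ft]; exact hmt
      rw [fi i h1 h2]; exact hφ i h1 h2
    · rcases (Fin.le_def.2 h1).eq_or_lt with h1 | h1
      · subst h1
        rw [fs, fi j (Fin.lt_def.2 (by omega)) (Fin.lt_def.2 (by omega))]
        exact hs j hij
      rcases (Fin.le_def.2 h2).eq_or_lt with h2 | h2
      · subst h2
        rw [ft, fi i h1 (Fin.lt_def.2 (by omega))]
        exact (ht i hij).symm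
      have h3 := Fin.lt_def.1 h1
      have h4 := Fin.lt_def.1 h2
      rw [fi i h1 (Fin.lt_def.2 (by omega)), fi j (Fin.lt_def.2 (by omega)) h2]
      exact hpair i j hij h1 h2
  obtain ⟨f, hf, he⟩ := hpartial.exists_isSignificantChain hS (by omega) (by omega)
  refine ⟨f, hf, ?_, ?_, fun i h1 h2 => ?_⟩
  · rw [he s le_rfl (by omega), fs]
  · rw [he t (by omega) le_rfl, ft]
  · rw [he i (Fin.lt_def.1 h1).le (Fin.lt_def.1 h2).le, fi i h1 h2]

section Runs

variable {M N : ℕ}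

/-- The gaps of the hole `j` in the samples with indices `n` and `n + 1` can be followed by chains:
their lower end points form a metric pair, and so do their upper end points. -/
def IsLinked (F : ℝ → Set ℝ) (H : Fin M → HoleData) (X : Fin (N + 1) → ℝ) (j : Fin M) (n : ℕ) :
    Prop :=
  ∃ i i' : Fin (N + 1), i.val = n ∧ i'.val = n + 1 ∧
    X i ∈ Set.Ioo (H j).c (H j).d ∧ X i' ∈ Set.Ioo (H j).c (H j).d ∧
    IsMetricPair (F (X i)) (F (X i')) ((H j).g (X i)) ((H j).g (X i')) ∧
    IsMetricPair (F (X i)) (F (X i')) ((H j).h (X i)) ((H j).h (X i'))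

/-- The samples strictly between the indices `s` and `t` form a maximal sequence of samples in
which the gaps of the hole `j` are linked. A hole that is thinner than its boundary moves
from one sample to the next (this may happen close to its end points) can have several such
sequences, and is then represented by several approximated holes. -/
structure IsRun (F : ℝ → Set ℝ) (H : Fin M → HoleData) (X : Fin (N + 1) → ℝ) (j : Fin M)
    (s t : Fin (N + 1)) : Prop where
  lt : s.val + 1 < t.val
  mem : ∀ i, s < i → i < t → X i ∈ Set.Ioo (H j).c (H j).d
  linked : ∀ n, s.val < n → n + 1 < t.val → IsLinked F H X j n
  not_left : ¬ IsLinked F H X j s.val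
  not_right : ¬ IsLinked F H X j (t.val - 1)

variable {F : ℝ → Set ℝ} {H : Fin M → HoleData} {X : Fin (N + 1) → ℝ}

theorem IsRun.unique {j : Fin M} {s t s' t' i : Fin (N + 1)} (h : IsRun F H X j s t)
    (h' : IsRun F H X j s' t') (hs : s < i) (ht : i < t) (hs' : s' < i) (ht' : i < t') :
    s = s' ∧ t = t' := by
  rw [Fin.lt_def] at hs ht hs' ht'
  constructor
  · rcases lt_trichotomy s.val s'.val with hlt | he | hlt
    · exact absurd (h.linked s' hlt (by omega)) h'.not_left
    · exact Fin.ext he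
    · exact absurd (h'.linked s hlt (by omega)) h.not_left
  · rcases lt_trichotomy t.val t'.val with hlt | he | hlt
    · exact absurd (h'.linked (t.val - 1) (by omega) (by omega)) h.not_right
    · exact Fin.ext he
    · exact absurd (h.linked (t'.val - 1) (by omega) (by omega)) h'.not_right

/-- Each gap lies in a maximal sequence of linked gaps, if the hole is seen neither in the first nor
in the last sample. -/
theorem exists_isRun {j : Fin M} (h0 : X 0 ∉ Set.Ioo (H j).c (H j).d)
    (hN : X (Fin.last N) ∉ Set.Ioo (H j).c (H j).d) {i : Fin (N + 1)}
    (hi : X i ∈ Set.Ioo (H j).c (H j).d) : ∃ s t, s < i ∧ i < t ∧ IsRun F H X j s t := by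
  classical
  set A := IsLinked F H X j with hA
  have hA0 : ¬ A 0 := by
    rintro ⟨i, i', h1, -, h2, -⟩
    rw [show i = 0 from Fin.ext h1] at h2
    exact h0 h2
  have hAN : ¬ A (N - 1) := by
    rintro ⟨i, i', h1, h1', h2, h3, -⟩
    rw [show i' = Fin.last N from Fin.ext (by simp; omega)] at h3
    exact hN h3
  have hi0 : 0 < i.val := by
    rcases Nat.eq_zero_or_pos i.val with h | h
    · rw [show i = 0 from Fin.ext h] at hi; exact absurd hi h0
    · exact h
  have hiN : i.val < N := by
    rcases (Nat.lt_succ_iff.1 i.2).eq_or_lt with h | h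
    · rw [show i = Fin.last N from Fin.ext h] at hi; exact absurd hi hN
    · exact h
  set s := Nat.findGreatest (fun n => ¬ A n) (i.val - 1) with hs
  have hs1 : ¬ A s := Nat.findGreatest_spec (P := fun n => ¬ A n) (Nat.zero_le _) hA0
  have hs2 : s ≤ i.val - 1 := Nat.findGreatest_le _
  have hs3 : ∀ n, s < n → n < i.val → A n := fun n h1 h2 => by
    by_contra hc
    exact Nat.findGreatest_is_greatest h1 (by omega) hc
  have hex : ∃ n, i.val ≤ n ∧ ¬ A n := ⟨N - 1, by omega, hAN⟩
  set t := Nat.find hex with ht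
  have ht1 := (Nat.find_spec hex).2
  have ht2 := (Nat.find_spec hex).1
  have ht3 : t ≤ N - 1 := Nat.find_le ⟨by omega, hAN⟩
  have ht4 : ∀ n, i.val ≤ n → n < t → A n := fun n h1 h2 => by
    by_contra hc
    exact Nat.find_min hex h2 ⟨h1, hc⟩
  rw [← ht] at ht1 ht2
  refine ⟨⟨s, by omega⟩, ⟨t + 1, by omega⟩, Fin.lt_def.2 (by simp only; omega),
    Fin.lt_def.2 (by simp only; omega), ⟨by simp only; omega, fun k h1 h2 => ?_,
    fun n h1 h2 => ?_, hs1, by simpa using ht1⟩⟩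
  · rw [Fin.lt_def] at h1 h2
    simp only at h1 h2
    rcases lt_trichotomy k.val i.val with h | h | h
    · obtain ⟨k', _, h3, -, h4, -⟩ := hs3 k h1 h
      rwa [Fin.ext h3] at h4
    · rwa [Fin.ext h]
    · obtain ⟨_, k', -, h3, -, h4, -⟩ := ht4 (k.val - 1) (by omega) (by omega)
      rwa [show k' = k from Fin.ext (by omega)] at h4
  · simp only at h1 h2
    rcases lt_or_ge n i.val with h | h
    · exact hs3 n h1 h
    · exact ht4 n h (by omega)

variable {a b L δ μ : ℝ}

/-- Where the gaps of a hole are not linked, the chains of its two boundaries can meet. -/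
theorem HasSeparatedHoles.exists_meeting_point (h : HasSeparatedHoles a b L δ F H)
    (hX : IsGrid a b μ X) (hμ : μ < δ) (hLμ : L * μ < δ) {j : Fin M} {i i' : Fin (N + 1)}
    (hii' : i.val + 1 = i'.val ∨ i'.val + 1 = i.val) (hi' : X i' ∈ Set.Ioo (H j).c (H j).d)
    (hn : ¬ (X i ∈ Set.Ioo (H j).c (H j).d ∧
      IsMetricPair (F (X i)) (F (X i')) ((H j).g (X i)) ((H j).g (X i')) ∧
      IsMetricPair (F (X i)) (F (X i')) ((H j).h (X i)) ((H j).h (X i')))) :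
    ∃ m ∈ significantPoints (fun k => F (X k)) i,
      IsMetricPair (F (X i)) (F (X i')) m ((H j).g (X i')) ∧
      IsMetricPair (F (X i)) (F (X i')) m ((H j).h (X i')) ∧
      (((H j).g (X i') + (H j).h (X i')) / 2 ∈ F (X i) →
        m = ((H j).g (X i') + (H j).h (X i')) / 2) := by
  have hstep := hX.abs_step_le hii'
  have hLstep : L * |X i - X i'| < δ :=
    (mul_le_mul_of_nonneg_left hstep h.L_nonneg).trans_lt hLμ
  have hgap' := h.isGap hi'
  have hpq' := hgap'.1
  have hnear : ∀ y ∈ Set.Icc ((H j).g (X i')) ((H j).h (X i')),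
      (X i ∈ Set.Icc (H j).c (H j).d → y ∉ Set.Ioo ((H j).g (X i)) ((H j).h (X i))) →
      y ∈ F (X i) := fun y hy =>
    h.mem_of_near (hX.mem i) (Set.Ioo_subset_Icc_self hi') hy (hstep.trans_lt hμ) hLstep
  by_cases hi : X i ∈ Set.Ioo (H j).c (H j).d
  · have hgap := h.isGap hi
    obtain ⟨m, -, h1, h2, h3, h4⟩ := SVF.exists_meeting_point hgap hgap'
      (fun y hy hyn => hnear y hy fun _ => hyn) (fun hc => hn ⟨hi, hc⟩)
    refine ⟨m, ?_, h1, h2, h3⟩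
    rcases h4 with rfl | rfl | rfl
    · exact IsGap.mid_mem_significantPoints (S := fun k => F (X k)) hii'.symm hgap' h1.1
    · exact discreteSample_subset_significantPoints (S := fun k => F (X k)) i
        (hgap.left_mem_discreteSample (h.values _ (hX.mem i)).2)
    · exact discreteSample_subset_significantPoints (S := fun k => F (X k)) i
        (hgap.right_mem_discreteSample (h.values _ (hX.mem i)).2)
  · have hm : ((H j).g (X i') + (H j).h (X i')) / 2 ∈ F (X i) :=
      hnear _ ⟨by linarith, by linarith⟩ fun hic hc =>
        hi (h.hasHoles.mem_Ioo_of_lt hic (hc.1.trans hc.2))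
    exact ⟨_, IsGap.mid_mem_significantPoints (S := fun k => F (X k)) hii'.symm hgap' hm,
      (hgap'.isMetricPair_left hm (by linarith) le_rfl).symm,
      (hgap'.isMetricPair_right hm (by linarith) le_rfl).symm, fun _ => rfl⟩

/-- Each maximal sequence of linked gaps is bounded by an approximated hole. -/
theorem IsRun.exists_isApproxHole (h : HasSeparatedHoles a b L δ F H)
    (hX : IsGrid a b μ X) (hμ : μ < δ) (hLμ : L * μ < δ) {j : Fin M} {s t : Fin (N + 1)}
    (hr : IsRun F H X j s t) :
    ∃ P : ChainPair N, IsApproxHole (fun i => F (X i)) P ∧ P.s = s ∧ P.t = t ∧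
      ∀ i, s < i → i < t → P.lo i = (H j).g (X i) ∧ P.hi i = (H j).h (X i) := by
  have hst := hr.lt
  have hS : ∀ i, IsFiniteUnionLike (F (X i)) := fun i => h.isFiniteUnionLike (hX.mem i)
  let s' : Fin (N + 1) := ⟨s.val + 1, by omega⟩
  let t' : Fin (N + 1) := ⟨t.val - 1, by omega⟩
  have hs's : s.val + 1 = s'.val := rfl
  have ht't : t'.val + 1 = t.val := by simp only [t']; omega
  have hs'mem : X s' ∈ Set.Ioo (H j).c (H j).d :=
    hr.mem s' (Fin.lt_def.2 (by omega)) (Fin.lt_def.2 (by omega))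
  have ht'mem : X t' ∈ Set.Ioo (H j).c (H j).d :=
    hr.mem t' (Fin.lt_def.2 (by omega)) (Fin.lt_def.2 (by omega))
  obtain ⟨ms, hms, hs1, hs2, hs3⟩ := h.exists_meeting_point hX hμ hLμ (Or.inl hs's) hs'mem
    (fun hc => hr.not_left ⟨s, s', rfl, rfl, hc.1, hs'mem, hc.2⟩)
  obtain ⟨mt, hmt, ht1, ht2, ht3⟩ := h.exists_meeting_point hX hμ hLμ (Or.inr ht't) ht'mem
    (fun hc => hr.not_right ⟨t', t, rfl, by omega, ht'mem, hc.1, hc.2.1.symm, hc.2.2.symm⟩)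
  have hpair : ∀ i k : Fin (N + 1), i.val + 1 = k.val → s < i → k < t →
      IsMetricPair (F (X i)) (F (X k)) ((H j).g (X i)) ((H j).g (X k)) ∧
      IsMetricPair (F (X i)) (F (X k)) ((H j).h (X i)) ((H j).h (X k)) := by
    intro i k hik h1 h2
    rw [Fin.lt_def] at h1 h2
    obtain ⟨i₁, k₁, hi₁, hk₁, -, -, h3⟩ := hr.linked i.val h1 (by omega)
    rwa [show i₁ = i from Fin.ext hi₁, show k₁ = k from Fin.ext (by omega)] at h3
  have hs_eq : ∀ i : Fin (N + 1), s.val + 1 = i.val → i = s' := fun i hi => Fin.ext (by omega)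
  have ht_eq : ∀ i : Fin (N + 1), i.val + 1 = t.val → i = t' := fun i hi => Fin.ext (by omega)
  obtain ⟨lo, hlo, los, lot, loi⟩ := exists_isSignificantChain_between (S := fun i => F (X i)) hS
    hst (φ := fun i => (H j).g (X i)) hms hmt
    (fun i h1 h2 => discreteSample_subset_significantPoints (S := fun i => F (X i)) i
      ((h.isGap (hr.mem i h1 h2)).left_mem_discreteSample (hS i).isCompact))
    (fun i k hik h1 h2 => (hpair i k hik h1 h2).1)
    (fun i hi => by rw [hs_eq i hi]; exact hs1) (fun i hi => by rw [ht_eq i hi]; exact ht1)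
  obtain ⟨hi, hhi, his, hit, hii⟩ := exists_isSignificantChain_between (S := fun i => F (X i)) hS
    hst (φ := fun i => (H j).h (X i)) hms hmt
    (fun i h1 h2 => discreteSample_subset_significantPoints (S := fun i => F (X i)) i
      ((h.isGap (hr.mem i h1 h2)).right_mem_discreteSample (hS i).isCompact))
    (fun i k hik h1 h2 => (hpair i k hik h1 h2).2)
    (fun i hi => by rw [hs_eq i hi]; exact hs2) (fun i hi => by rw [ht_eq i hi]; exact ht2)
  have hs'lt : s < s' ∧ s' < t := ⟨Fin.lt_def.2 (by omega), Fin.lt_def.2 (by omega)⟩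
  have ht'lt : s < t' ∧ t' < t := ⟨Fin.lt_def.2 (by omega), Fin.lt_def.2 (by omega)⟩
  refine ⟨⟨s, t, lo, hi⟩, ⟨hst, hlo, hhi, fun i h1 h2 => ?_, los.trans his.symm,
    lot.trans hit.symm, fun i hi' hm => ?_, fun i hi' hm => ?_⟩, rfl, rfl,
    fun i h1 h2 => ⟨loi i h1 h2, hii i h1 h2⟩⟩
  · dsimp only at h1 h2 ⊢
    rw [loi i h1 h2, hii i h1 h2]
    exact h.isGap (hr.mem i h1 h2)
  · dsimp only at hi' hm ⊢
    have he := hs_eq i hi'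
    subst he
    rw [loi _ hs'lt.1 hs'lt.2, hii _ hs'lt.1 hs'lt.2] at hm ⊢
    rw [los, hs3 hm]
  · dsimp only at hi' hm ⊢
    have he := ht_eq i hi'
    subst he
    rw [loi _ ht'lt.1 ht'lt.2, hii _ ht'lt.1 ht'lt.2] at hm ⊢
    rw [lot, ht3 hm]

/-- On a sufficiently fine grid the algorithm has an output. -/
theorem HasSeparatedHoles.exists_isOutput (h : HasSeparatedHoles a b L δ F H)
    (hX : IsGrid a b μ X) (hμ : μ < δ) (hLμ : L * μ < δ) :
    ∃ G, IsOutput X (fun i => F (X i)) G := by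
  classical
  let ι := {r : Fin M × Fin (N + 1) × Fin (N + 1) // IsRun F H X r.1 r.2.1 r.2.2}
  have : Finite ι := inferInstance
  obtain ⟨K, ⟨e⟩⟩ := Finite.exists_equiv_fin ι
  choose P hP hPs hPt hPi using fun r : ι => r.2.exists_isApproxHole h hX hμ hLμ
  refine ⟨_, K, fun k => P (e.symm k), fun k => hP _, fun i p q hg => ?_, fun x => rfl⟩
  obtain ⟨j, hj, rfl, rfl⟩ := h.exists_of_isGap (hX.mem i) hg
  have h0 : X 0 ∉ Set.Ioo (H j).c (H j).d := fun hc => by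
    linarith [hc.1, h.left_le j, hX.first_le]
  have hN : X (Fin.last N) ∉ Set.Ioo (H j).c (H j).d := fun hc => by
    linarith [hc.2, h.le_right j, hX.le_last]
  obtain ⟨s, t, hs, ht, hr⟩ := exists_isRun (F := F) h0 hN hj
  let r : ι := ⟨(j, s, t), hr⟩
  refine ⟨e r, ?_, fun k hk => ?_⟩
  · simp only [Equiv.symm_apply_apply]
    rw [hPs, hPt]
    exact ⟨hs, ht, hPi r i hs ht⟩
  · obtain ⟨h1, h2, h3, -⟩ := hk
    dsimp only at h1 h2 h3
    rw [← e.symm_apply_eq]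
    obtain ⟨⟨⟨j', s', t'⟩, hr'⟩, hk'⟩ : ∃ r', e.symm k = r' := ⟨_, rfl⟩
    rw [hk'] at h1 h2 h3 ⊢
    rw [hPs] at h1
    rw [hPt] at h2
    dsimp only at h1 h2 hr'
    rw [(hPi ⟨(j', s', t'), hr'⟩ i h1 h2).1] at h3
    have hjj : j' = j := h.hole_eq_of_g_eq (Set.Ioo_subset_Icc_self (hr'.mem i h1 h2))
      (Set.Ioo_subset_Icc_self hj) h3
    subst hjj
    obtain ⟨rfl, rfl⟩ := hr'.unique hr h1 h2 hs ht
    rfl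

end Runs

end SVF

namespace SVF

/-! ### The Hausdorff distance of two set-valued functions with close boundaries -/

/-- The point of the hole's interval closest to `x`. -/
noncomputable def HoleData.proj (H : HoleData) (x : ℝ) : ℝ := max H.c (min x H.d)

theorem HoleData.proj_mem {H : HoleData} (h : H.c ≤ H.d) (x : ℝ) :
    H.proj x ∈ Set.Icc H.c H.d :=
  ⟨le_max_left _ _, max_le h (min_le_right _ _)⟩

theorem HoleData.proj_of_mem {H : HoleData} {x : ℝ} (h : x ∈ Set.Icc H.c H.d) : H.proj x = x := by
  rw [HoleData.proj, min_eq_left h.2, max_eq_right h.1]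

theorem HoleData.abs_proj_sub_le {H : HoleData} (x : ℝ) {u : ℝ} (hu : u ∈ Set.Icc H.c H.d) :
    |H.proj x - u| ≤ |x - u| := by
  rw [HoleData.proj]
  rcases le_total x H.d with h1 | h1
  · rw [min_eq_left h1]
    rcases le_total H.c x with h2 | h2
    · rw [max_eq_right h2]
    · rw [max_eq_left h2, abs_of_nonpos (by linarith [hu.1]), abs_of_nonpos (by linarith [hu.1])]
      linarith
  · rw [min_eq_right h1, max_eq_right (hu.1.trans hu.2), abs_of_nonneg (by linarith [hu.2]),
      abs_of_nonneg (by linarith [hu.2])]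
    linarith

theorem HoleData.abs_sub_proj_le {H : HoleData} (x : ℝ) {u : ℝ} (hu : u ∈ Set.Icc H.c H.d) :
    |x - H.proj x| ≤ |x - u| := by
  rw [HoleData.proj]
  rcases le_total x H.d with h1 | h1
  · rw [min_eq_left h1]
    rcases le_total H.c x with h2 | h2
    · rw [max_eq_right h2]; simp
    · rw [max_eq_left h2, abs_of_nonpos (by linarith [hu.1]), abs_of_nonpos (by linarith [hu.1])]
      linarith [hu.1]
  · rw [min_eq_right h1, max_eq_right (hu.1.trans hu.2), abs_of_nonneg (by linarith [hu.2]),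
      abs_of_nonneg (by linarith [hu.2])]
    linarith [hu.2]

theorem isCompact_ofBoundaries {ι : Type} (l u : ℝ → ℝ) (H : ι → HoleData) (x : ℝ) :
    IsCompact (ofBoundaries l u H x) := by
  refine isCompact_uIcc.diff ?_
  have : {y | ∃ j, x ∈ Set.Icc (H j).c (H j).d ∧ y ∈ Set.Ioo ((H j).g x) ((H j).h x)} =
      ⋃ j, ⋃ _ : x ∈ Set.Icc (H j).c (H j).d, Set.Ioo ((H j).g x) ((H j).h x) := by
    ext y; simp only [Set.mem_ofPred_eq, Set.mem_iUnion, exists_prop]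
  rw [this]
  exact isOpen_iUnion fun j => isOpen_iUnion fun _ => isOpen_Ioo

namespace HasSeparatedHoles

variable {a b L δ ε : ℝ} {M : ℕ} {F : ℝ → Set ℝ} {H : Fin M → HoleData}

/-- Close boundaries give close values: `l`, `u` approximate the lower and the upper boundary at
`x`; each hole `Q k` over `x` approximates a hole of `F`, extended to `x` by its values at the
closest point of its interval; and each hole of `F` over `x` is thin or approximated by some
`Q k`. Several `Q k` may approximate the same hole. -/
theorem hausdorffDist_ofBoundaries_le (h : HasSeparatedHoles a b L δ F H) {ι : Type}
    {l u : ℝ → ℝ} {Q : ι → HoleData} {x : ℝ} (hx : x ∈ Set.Icc a b) (hε : 4 * ε < δ)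
    (hl : |l x - lower F x| ≤ ε) (hu : |u x - upper F x| ≤ ε)
    (hQ : ∀ k, x ∈ Set.Icc (Q k).c (Q k).d → ∃ j,
      |x - (H j).proj x| ≤ ε ∧ L * |x - (H j).proj x| ≤ ε ∧
      |(Q k).g x - (H j).g ((H j).proj x)| ≤ ε ∧ |(Q k).h x - (H j).h ((H j).proj x)| ≤ ε)
    (hH : ∀ j, x ∈ Set.Icc (H j).c (H j).d → (H j).h x - (H j).g x ≤ ε ∨
      ∃ k, x ∈ Set.Icc (Q k).c (Q k).d ∧
        |(Q k).g x - (H j).g x| ≤ ε ∧ |(Q k).h x - (H j).h x| ≤ ε) :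
    (ofBoundaries l u Q x).Nonempty ∧ IsCompact (ofBoundaries l u Q x) ∧
      Metric.hausdorffDist (ofBoundaries l u Q x) (F x) ≤ 2 * ε := by
  have hε0 : 0 ≤ ε := (abs_nonneg _).trans hl
  obtain ⟨hl1, hl2⟩ := abs_le.1 hl
  obtain ⟨hu1, hu2⟩ := abs_le.1 hu
  have hlu := h.lower_le_upper hx
  have mem_G : ∀ y, y ∈ ofBoundaries l u Q x ↔ y ∈ Set.uIcc (l x) (u x) ∧
      ∀ k, x ∈ Set.Icc (Q k).c (Q k).d → y ∉ Set.Ioo ((Q k).g x) ((Q k).h x) := fun y => by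
    simp only [ofBoundaries, Set.mem_sdiff, Set.mem_ofPred_eq, not_exists, not_and]
  have proj_mem : ∀ j, (H j).proj x ∈ Set.Icc (H j).c (H j).d := fun j =>
    HoleData.proj_mem (h.hasHoles.lt j).le x
  -- the extended holes keep their distance to the lower and the upper boundary at `x`
  have hlow : ∀ j, L * |x - (H j).proj x| ≤ ε → lower F x + δ - ε ≤ (H j).g ((H j).proj x) :=
    fun j hj => by
      have h1 := (abs_le.1 (h.isLip.abs_lower_sub_le h.values hx
        (h.Icc_subset j (proj_mem j)))).2
      linarith [h.lower_le j _ (proj_mem j)]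
  have hupp : ∀ j, L * |x - (H j).proj x| ≤ ε → (H j).h ((H j).proj x) ≤ upper F x - δ + ε :=
    fun j hj => by
      have h1 := (abs_le.1 (h.isLip.abs_upper_sub_le h.values hx
        (h.Icc_subset j (proj_mem j)))).1
      linarith [h.le_upper j _ (proj_mem j)]
  -- a point next to the hole `j` lies in no approximated hole that belongs to another hole
  have hsep : ∀ j k, |x - (H j).proj x| ≤ ε → x ∈ Set.Icc (Q k).c (Q k).d →
      ∀ y ∈ Set.Icc ((H j).g ((H j).proj x)) ((H j).h ((H j).proj x)), ∀ z, |y - z| ≤ ε →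
      z ∈ Set.Ioo ((Q k).g x) ((Q k).h x) →
      (H j).g ((H j).proj x) - ε < z ∧ z < (H j).h ((H j).proj x) + ε := by
    intro j k hj hk y hy z hyz hz
    obtain ⟨j', h1, h2, h3, h4⟩ := hQ k hk
    obtain ⟨hyz1, hyz2⟩ := abs_le.1 hyz
    obtain ⟨h31, h32⟩ := abs_le.1 h3
    obtain ⟨h41, h42⟩ := abs_le.1 h4
    have hgh := h.hasHoles.g_le_h j' (proj_mem j')
    have hy' : ∃ y' ∈ Set.Icc ((H j').g ((H j').proj x)) ((H j').h ((H j').proj x)),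
        |z - y'| ≤ ε := by
      rcases le_total z ((H j').g ((H j').proj x)) with hz1 | hz1
      · exact ⟨_, ⟨le_rfl, hgh⟩, abs_le.2 ⟨by linarith [hz.1], by linarith⟩⟩
      rcases le_total ((H j').h ((H j').proj x)) z with hz2 | hz2
      · exact ⟨_, ⟨hgh, le_rfl⟩, abs_le.2 ⟨by linarith, by linarith [hz.2]⟩⟩
      · exact ⟨z, ⟨hz1, hz2⟩, by simpa using hε0⟩
    obtain ⟨y', hy', hzy'⟩ := hy'
    have hjj : j = j' := h.eq_of_near (proj_mem j) hy (proj_mem j') hy'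
      (by have := abs_sub_le ((H j).proj x) x ((H j').proj x)
          rw [abs_sub_comm _ x] at this; linarith)
      (by have := abs_sub_le y z y'; linarith)
    subst hjj
    exact ⟨by linarith [hz.1], by linarith [hz.2]⟩
  have toG : ∀ y ∈ F x, ∃ z ∈ ofBoundaries l u Q x, |y - z| ≤ 2 * ε := by
    intro y hy
    have hyF := (h.mem_iff hx).1 hy
    by_cases hin : ∃ k, x ∈ Set.Icc (Q k).c (Q k).d ∧ y ∈ Set.Ioo ((Q k).g x) ((Q k).h x)
    · obtain ⟨k, hk, hyk⟩ := hin
      obtain ⟨j, h1, h2, h3, h4⟩ := hQ k hk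
      obtain ⟨h31, h32⟩ := abs_le.1 h3
      obtain ⟨h41, h42⟩ := abs_le.1 h4
      have hgh := h.hasHoles.g_le_h j (proj_mem j)
      have hlj := hlow j h2
      have huj := hupp j h2
      have hside : y ≤ (H j).g ((H j).proj x) ∨ (H j).h ((H j).proj x) ≤ y := by
        by_contra! hc
        have hlt := h.hasHoles.mem_Ioo_of_lt (proj_mem j) (hc.1.trans hc.2)
        -- outside of its interval the extended hole has width zero
        have hxj : x ∈ Set.Icc (H j).c (H j).d := by
          rw [HoleData.proj] at hlt
          refine ⟨?_, ?_⟩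
          · by_contra! hc'
            rw [max_eq_left ((min_le_left _ _).trans hc'.le)] at hlt
            exact lt_irrefl _ hlt.1
          · by_contra! hc'
            rw [min_eq_right hc'.le] at hlt
            exact absurd hlt.2 (not_lt.2 (le_max_right _ _))
        rw [HoleData.proj_of_mem hxj] at hc
        exact hyF.2 j hxj hc
      rcases hside with hs | hs
      -- just below the hole `j` of `F`, no approximation of it removes anything
      · refine ⟨(H j).g ((H j).proj x) - ε, (mem_G _).2 ⟨?_, fun k' hk' hz => ?_⟩,
          abs_le.2 ⟨by linarith [hyk.1], by linarith⟩⟩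
        · rw [Set.uIcc_of_le (by linarith)]
          exact ⟨by linarith, by linarith⟩
        · have := (hsep j k' h1 hk' _ ⟨le_rfl, hgh⟩ _
            (by rw [sub_sub_cancel, abs_of_nonneg hε0]) hz).1
          exact lt_irrefl _ this
      · refine ⟨(H j).h ((H j).proj x) + ε, (mem_G _).2 ⟨?_, fun k' hk' hz => ?_⟩,
          abs_le.2 ⟨by linarith, by linarith [hyk.2]⟩⟩
        · rw [Set.uIcc_of_le (by linarith)]
          exact ⟨by linarith, by linarith⟩
        · have := (hsep j k' h1 hk' _ ⟨hgh, le_rfl⟩ _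
            (by rw [sub_add_cancel_left, abs_neg, abs_of_nonneg hε0]) hz).2
          exact lt_irrefl _ this
    by_cases hyu : y ∈ Set.uIcc (l x) (u x)
    · exact ⟨y, (mem_G y).2 ⟨hyu, fun k hk hyk => hin ⟨k, hk, hyk⟩⟩, by simpa using hε0⟩
    rw [Set.mem_uIcc] at hyu
    rcases lt_or_ge y (min (l x) (u x)) with hlt | hge
    · refine ⟨min (l x) (u x), (mem_G _).2 ⟨⟨le_rfl, min_le_max⟩, fun k hk hz => ?_⟩, ?_⟩
      · obtain ⟨j, h1, h2, h3, h4⟩ := hQ k hk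
        have hlj := hlow j h2
        linarith [hz.1, min_le_left (l x) (u x), (abs_le.1 h3).1]
      · rw [abs_of_neg (by linarith)]
        linarith [hyF.1.1, min_le_left (l x) (u x)]
    have hlt : max (l x) (u x) < y := by
      rcases le_total (l x) (u x) with h1 | h1
      · rw [min_eq_left h1] at hge; rw [max_eq_right h1]
        by_contra! hc; exact hyu (Or.inl ⟨hge, hc⟩)
      · rw [min_eq_right h1] at hge; rw [max_eq_left h1]
        by_contra! hc; exact hyu (Or.inr ⟨hge, hc⟩)
    refine ⟨max (l x) (u x), (mem_G _).2 ⟨⟨min_le_max, le_rfl⟩, fun k hk hz => ?_⟩, ?_⟩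
    · obtain ⟨j, h1, h2, h3, h4⟩ := hQ k hk
      have huj := hupp j h2
      linarith [hz.2, le_max_right (l x) (u x), (abs_le.1 h4).2]
    · rw [abs_of_pos (by linarith)]
      linarith [hyF.1.2, le_max_right (l x) (u x)]
  have toF : ∀ z ∈ ofBoundaries l u Q x, ∃ y ∈ F x, |z - y| ≤ 2 * ε := by
    intro z hz
    obtain ⟨hzu, hzQ⟩ := (mem_G z).1 hz
    have hmin : lower F x - ε ≤ min (l x) (u x) := le_min (by linarith) (by linarith)
    have hmax : max (l x) (u x) ≤ upper F x + ε := max_le (by linarith) (by linarith)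
    rcases lt_or_ge z (lower F x) with hlt | hge
    · exact ⟨lower F x, (h.values x hx).2.sInf_mem (h.values x hx).1,
        abs_le.2 ⟨by linarith [hzu.1], by linarith⟩⟩
    rcases lt_or_ge (upper F x) z with hlt' | hge'
    · exact ⟨upper F x, (h.values x hx).2.sSup_mem (h.values x hx).1,
        abs_le.2 ⟨by linarith, by linarith [hzu.2]⟩⟩
    by_cases hin : ∃ j, x ∈ Set.Icc (H j).c (H j).d ∧ z ∈ Set.Ioo ((H j).g x) ((H j).h x)
    · obtain ⟨j, hxj, hzj⟩ := hin
      rcases hH j hxj with hthin | ⟨k, hk, h1, h2⟩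
      · exact ⟨_, h.g_mem hxj, abs_le.2 ⟨by linarith [hzj.1], by linarith [hzj.2]⟩⟩
      rcases le_or_gt z ((Q k).g x) with hz1 | hz1
      · exact ⟨_, h.g_mem hxj, abs_le.2 ⟨by linarith [hzj.1], by linarith [(abs_le.1 h1).2]⟩⟩
      rcases le_or_gt ((Q k).h x) z with hz2 | hz2
      · exact ⟨_, h.h_mem hxj, abs_le.2 ⟨by linarith [(abs_le.1 h2).1], by linarith [hzj.2]⟩⟩
      · exact absurd ⟨hz1, hz2⟩ (hzQ k hk)
    · exact ⟨z, (h.mem_iff hx).2 ⟨⟨hge, hge'⟩, fun j hj hzj => hin ⟨j, hj, hzj⟩⟩,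
        by simpa using hε0⟩
  obtain ⟨y₀, hy₀⟩ := (h.values x hx).1
  obtain ⟨z₀, hz₀, -⟩ := toG y₀ hy₀
  exact ⟨⟨z₀, hz₀⟩, isCompact_ofBoundaries l u Q x,
    Metric.hausdorffDist_le_of_mem_dist (by linarith) toF toG⟩

end HasSeparatedHoles

end SVF

namespace SVF

open Filter Topology

/-! ### Convergence on the Chebyshev grid -/

theorem chebyshevPoint_isGrid {a b : ℝ} (hab : a < b) (N : ℕ) :
    IsGrid a b ((b - a) * Real.pi / ((N : ℝ) + 1)) (chebyshevPoint a b N) := by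
  have hπ := Real.pi_pos
  have hn : (0 : ℝ) < (N : ℝ) + 1 := by positivity
  have hba : 0 < b - a := by linarith
  have hcos := fun u v => Real.lipschitzWith_cos.dist_le_mul u v
  simp only [Real.dist_eq, NNReal.coe_one, one_mul] at hcos
  have hbound : (b - a) / 2 * (Real.pi / (2 * ((N : ℝ) + 1))) ≤
      (b - a) * Real.pi / ((N : ℝ) + 1) := by
    rw [div_mul_div_comm, div_le_div_iff₀ (by positivity) hn]
    have : 0 < (b - a) * Real.pi * ((N : ℝ) + 1) := by positivity
    linarith
  refine ⟨chebyshevPoint_mem hab.le N, chebyshevPoint_strictMono hab N, fun i j hij => ?_, ?_, ?_⟩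
  · rw [chebyshevPoint_eq, chebyshevPoint_eq, ← hij]
    refine (le_abs_self _).trans ((chebyshevNode_succ_sub_le hab N i).trans ?_)
    rw [div_mul_div_comm, div_le_div_iff₀ (by positivity) hn]
    have : 0 < (b - a) * Real.pi * ((N : ℝ) + 1) := by positivity
    linarith
  · rw [chebyshevPoint_eq, chebyshevNode]
    have h0 : chebyshevAngle N ((0 : Fin (N + 1)) : ℕ) = Real.pi / (2 * ((N : ℝ) + 1)) := by
      rw [chebyshevAngle]; simp
    have h1 := (le_abs_self _).trans (hcos 0 (chebyshevAngle N ((0 : Fin (N + 1)) : ℕ)))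
    rw [Real.cos_zero, zero_sub, abs_neg, h0, abs_of_pos (by positivity)] at h1
    rw [h0]
    nlinarith [mul_le_mul_of_nonneg_left h1 (by linarith : 0 ≤ (b - a) / 2)]
  · rw [chebyshevPoint_eq, chebyshevNode]
    have h0 : Real.pi - chebyshevAngle N (Fin.last N : ℕ) = Real.pi / (2 * ((N : ℝ) + 1)) := by
      rw [chebyshevAngle, Fin.val_last]; field_simp; ring
    have h1 := (le_abs_self _).trans (hcos (chebyshevAngle N (Fin.last N : ℕ)) Real.pi)
    rw [Real.cos_pi, abs_sub_comm, h0, abs_of_pos (by positivity)] at h1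
    nlinarith [mul_le_mul_of_nonneg_left h1 (by linarith : 0 ≤ (b - a) / 2)]

namespace IsGrid

variable {a b μ L : ℝ} {N : ℕ} {X : Fin (N + 1) → ℝ}

/-- A value between two nodes lies between two consecutive nodes in the same range. -/
theorem exists_step (X : Fin (N + 1) → ℝ) {s t : Fin (N + 1)} (hst : s < t) {x : ℝ}
    (hs : X s ≤ x) (ht : x ≤ X t) :
    ∃ i j : Fin (N + 1), i.val + 1 = j.val ∧ s ≤ i ∧ j ≤ t ∧ X i ≤ x ∧ x ≤ X j := by
  classical
  set A := Finset.univ.filter fun i : Fin (N + 1) => i < t ∧ X i ≤ x with hA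
  have hsA : s ∈ A := by simp [hA, hst, hs]
  have hmem := A.max'_mem ⟨s, hsA⟩
  set i := A.max' ⟨s, hsA⟩ with hi
  have hi' : i < t ∧ X i ≤ x := by simpa [hA] using hmem
  have hit := Fin.lt_def.1 hi'.1
  let j : Fin (N + 1) := ⟨i.val + 1, by omega⟩
  have hjt : j ≤ t := Fin.le_def.2 (by simp only [j]; omega)
  refine ⟨i, j, rfl, A.le_max' s hsA, hjt, hi'.2, ?_⟩
  rcases hjt.eq_or_lt with h | h
  · rw [h]; exact ht
  · by_contra! hc
    have := A.le_max' j (by simp [hA, h, hc.le])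
    rw [← hi, Fin.le_def] at this
    simp only [j] at this
    omega

theorem exists_near (hX : IsGrid a b μ X) {x : ℝ} (hx : x ∈ Set.Icc a b) :
    ∃ i, |x - X i| ≤ μ := by
  rcases le_total x (X 0) with h0 | h0
  · exact ⟨0, by rw [abs_of_nonpos (by linarith)]; linarith [hx.1, hX.first_le]⟩
  rcases le_total (X (Fin.last N)) x with hN | hN
  · exact ⟨Fin.last N, by rw [abs_of_nonneg (by linarith)]; linarith [hx.2, hX.le_last]⟩
  rcases (Fin.zero_le (Fin.last N)).eq_or_lt with h | h
  · have hμ : 0 ≤ μ := (sub_nonneg.2 (hX.mem 0).1).trans hX.first_le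
    exact ⟨0, by rw [← h] at hN; rw [le_antisymm hN h0]; simpa using hμ⟩
  · obtain ⟨i, j, hij, -, -, hi, hj⟩ := IsGrid.exists_step X h h0 hN
    exact ⟨i, by rw [abs_of_nonneg (by linarith)]; linarith [hX.step_le i j hij]⟩

theorem exists_near_between (hX : IsGrid a b μ X) {s t : Fin (N + 1)} (hst : s.val + 1 < t.val)
    {x : ℝ} (hs : X s ≤ x) (ht : x ≤ X t) : ∃ i, s < i ∧ i < t ∧ |x - X i| ≤ μ := by
  obtain ⟨i, j, hij, hsi, hjt, hi, hj⟩ := IsGrid.exists_step X (Fin.lt_def.2 (by omega)) hs ht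
  have hstep := hX.step_le i j hij
  rcases hsi.eq_or_lt with h | h
  · refine ⟨j, Fin.lt_def.2 (by omega), Fin.lt_def.2 (by rw [h] at hst; omega), ?_⟩
    rw [abs_of_nonpos (by linarith)]; linarith
  · refine ⟨i, h, Fin.lt_def.2 (by rw [Fin.le_def] at hjt; omega), ?_⟩
    rw [abs_of_nonneg (by linarith)]; linarith

/-- A sequence of values that satisfies a Lipschitz condition at consecutive grid points extends to
a Lipschitz function. -/
theorem exists_lipschitz_extension (hX : IsGrid a b μ X) (hL : 0 ≤ L) {f : Fin (N + 1) → ℝ}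
    (hf : ∀ i j : Fin (N + 1), i.val + 1 = j.val → |f i - f j| ≤ L * |X i - X j|) :
    ∃ φ : ℝ → ℝ, (∀ u v, |φ u - φ v| ≤ L * |u - v|) ∧ ∀ i, φ (X i) = f i := by
  have key : ∀ (n : ℕ) (i j : Fin (N + 1)), i.val + n = j.val → |f i - f j| ≤ L * (X j - X i) := by
    intro n
    induction n with
    | zero =>
      intro i j hij
      rw [show i = j from Fin.ext (by omega)]; simp
    | succ n ih =>
      intro i j hij
      let k : Fin (N + 1) := ⟨i.val + n, by omega⟩
      have hkj : k.val + 1 = j.val := by simp only [k]; omega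
      have h1 := ih i k rfl
      have h2 := hf k j hkj
      have h3 := hX.strictMono (Fin.lt_def.2 (by omega : k.val < j.val))
      rw [abs_sub_comm (X k), abs_of_pos (sub_pos.2 h3)] at h2
      have := abs_sub_le (f i) (f k) (f j)
      linarith
  have hall : ∀ i j, |f i - f j| ≤ L * |X i - X j| := by
    have hle : ∀ i j : Fin (N + 1), i ≤ j → |f i - f j| ≤ L * |X i - X j| := fun i j hij => by
      have h1 := key (j.val - i.val) i j (by rw [Fin.le_def] at hij; omega)
      have h2 := hX.strictMono.monotone hij
      rwa [abs_sub_comm (X i), abs_of_nonneg (sub_nonneg.2 h2)]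
    intro i j
    rcases le_total i j with h | h
    · exact hle i j h
    · rw [abs_sub_comm, abs_sub_comm (X i)]; exact hle j i h
  have hinv := Function.leftInverse_invFun hX.strictMono.injective
  have hlip : LipschitzOnWith L.toNNReal (fun x => f (Function.invFun X x)) (Set.range X) := by
    refine LipschitzOnWith.of_dist_le_mul ?_
    rintro _ ⟨i, rfl⟩ _ ⟨j, rfl⟩
    rw [hinv i, hinv j, Real.dist_eq, Real.dist_eq, Real.coe_toNNReal _ hL]
    exact hall i j
  obtain ⟨φ, hφ, he⟩ := hlip.extend_real
  refine ⟨φ, fun u v => ?_, fun i => ?_⟩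
  · have := hφ.dist_le_mul u v
    rwa [Real.dist_eq, Real.dist_eq, Real.coe_toNNReal _ hL] at this
  · rw [← he ⟨i, rfl⟩]; simp only [hinv i]

end IsGrid

/-- The bound of `abs_interp_chebyshev_sub_le` for the interpolation error. -/
noncomputable def interpolationError (a b L : ℝ) (N : ℕ) : ℝ :=
  20 * Real.pi * L * (b - a) * ((1 + Real.log ((N : ℝ) + 1)) / ((N : ℝ) + 1))

theorem interpolationError_nonneg {a b L : ℝ} (hab : a ≤ b) (hL : 0 ≤ L) (N : ℕ) :
    0 ≤ interpolationError a b L N := by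
  have : 0 ≤ b - a := by linarith
  have : 0 ≤ Real.log ((N : ℝ) + 1) :=
    Real.log_nonneg (by linarith [(by positivity : (0 : ℝ) ≤ N)])
  have := Real.pi_pos
  unfold interpolationError; positivity

theorem abs_interp_sub_le_of_step {a b L : ℝ} (hab : a < b) (hL : 0 ≤ L) {N : ℕ}
    {f : Fin (N + 1) → ℝ}
    (hf : ∀ i j : Fin (N + 1), i.val + 1 = j.val →
      |f i - f j| ≤ L * |chebyshevPoint a b N i - chebyshevPoint a b N j|)
    {x : ℝ} (hx : x ∈ Set.Icc a b) (i : Fin (N + 1)) :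
    |interp (chebyshevPoint a b N) f x - f i| ≤
      interpolationError a b L N + L * |x - chebyshevPoint a b N i| := by
  obtain ⟨φ, hφ, he⟩ := (chebyshevPoint_isGrid hab N).exists_lipschitz_extension hL hf
  have h1 := abs_interp_chebyshev_sub_le hab hL hφ N hx
  simp only [he] at h1
  have h2 := hφ x (chebyshevPoint a b N i)
  rw [he] at h2
  exact (abs_sub_le _ (φ x) _).trans (add_le_add h1 h2)

/-- Consecutive members of a metric chain differ by at most the Hausdorff distance of the samples. -/
theorem IsMetricChain.abs_sub_le {a b L : ℝ} {F : ℝ → Set ℝ} (hLip : IsLip a b L F)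
    (hF : ∀ x ∈ Set.Icc a b, (F x).Nonempty ∧ IsCompact (F x)) {N : ℕ} {X : Fin (N + 1) → ℝ}
    (hX : ∀ i, X i ∈ Set.Icc a b) {f : Fin (N + 1) → ℝ} (hf : IsMetricChain (fun i => F (X i)) f)
    (i j : Fin (N + 1)) (hij : i.val + 1 = j.val) : |f i - f j| ≤ L * |X i - X j| := by
  let k : Fin N := ⟨i.val, by omega⟩
  obtain ⟨h1, h2, h3⟩ := hf.2 k
  have hi : k.castSucc = i := Fin.ext rfl
  have hj : k.succ = j := Fin.ext (by simpa [k] using hij)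
  rw [hi] at h1 h3
  rw [hj] at h2 h3
  rcases h3 with h3 | h3
  · rw [h3, abs_sub_comm]; exact hLip.infDist_le hF (hX j) (hX i) h2
  · rw [h3]; exact hLip.infDist_le hF (hX i) (hX j) h1

/-- The distance of an output to `F`, in terms of the mesh size `μ` and the interpolation error. -/
theorem HasSeparatedHoles.hausdorffDist_output_le {a b L δ : ℝ} {M N : ℕ} {F : ℝ → Set ℝ}
    {H : Fin M → HoleData} (h : HasSeparatedHoles a b L δ F H) {μ ε : ℝ}
    (hX : IsGrid a b μ (chebyshevPoint a b N)) (hμδ : μ < δ)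
    (hε : interpolationError a b L N + (2 * L + 1) * μ ≤ ε) (hεδ : 4 * ε < δ) {G : ℝ → Set ℝ}
    (hG : IsOutput (chebyshevPoint a b N) (fun i => F (chebyshevPoint a b N i)) G)
    {x : ℝ} (hx : x ∈ Set.Icc a b) :
    (G x).Nonempty ∧ IsCompact (G x) ∧ Metric.hausdorffDist (G x) (F x) ≤ 2 * ε := by
  obtain ⟨K, P, hP, hgap, hGx⟩ := hG
  set X := chebyshevPoint a b N with hXdef
  have hL := h.L_nonneg
  have hab := h.lt
  have hμ0 : 0 ≤ μ := (sub_nonneg.2 (hX.mem 0).1).trans hX.first_le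
  have hLμ0 : 0 ≤ L * μ := mul_nonneg hL hμ0
  have hI0 : 0 ≤ interpolationError a b L N := interpolationError_nonneg hab.le hL N
  -- a chain whose value at a node near `x` is close to `v` has an interpolant close to `v` at `x`
  have close : ∀ {f : Fin (N + 1) → ℝ} {v : ℝ} (i : Fin (N + 1)),
      (∀ i j : Fin (N + 1), i.val + 1 = j.val → |f i - f j| ≤ L * |X i - X j|) →
      |x - X i| ≤ μ → |f i - v| ≤ L * |x - X i| → |interp X f x - v| ≤ ε := by
    intro f v i hf hxi hv
    have h1 := abs_interp_sub_le_of_step hab hL hf hx i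
    have h2 := mul_le_mul_of_nonneg_left hxi hL
    have h3 := abs_sub_le (interp X f x) (f i) v
    linarith
  have hchain_lo : ∀ k, ∀ i j : Fin (N + 1), i.val + 1 = j.val →
      |(P k).lo i - (P k).lo j| ≤ L * |X i - X j| := fun k =>
    (hP k).lo_chain.1.abs_sub_le h.isLip h.values hX.mem
  have hchain_hi : ∀ k, ∀ i j : Fin (N + 1), i.val + 1 = j.val →
      |(P k).hi i - (P k).hi j| ≤ L * |X i - X j| := fun k =>
    (hP k).hi_chain.1.abs_sub_le h.isLip h.values hX.mem
  rw [hGx]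
  obtain ⟨i₀, hi₀⟩ := hX.exists_near hx
  refine h.hausdorffDist_ofBoundaries_le hx hεδ ?_ ?_ (fun k hk => ?_) (fun j hj => ?_)
  · refine close i₀ (fun i j _ => h.isLip.abs_lower_sub_le h.values (hX.mem i) (hX.mem j)) hi₀ ?_
    rw [abs_sub_comm x]
    exact h.isLip.abs_lower_sub_le h.values (hX.mem i₀) hx
  · refine close i₀ (fun i j _ => h.isLip.abs_upper_sub_le h.values (hX.mem i) (hX.mem j)) hi₀ ?_
    rw [abs_sub_comm x]
    exact h.isLip.abs_upper_sub_le h.values (hX.mem i₀) hx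
  · obtain ⟨i, hsi, hit, hxi⟩ := hX.exists_near_between (hP k).lt hk.1 hk.2
    obtain ⟨j, hj, hlo, hhi⟩ := h.exists_of_isGap (hX.mem i) ((hP k).gap i hsi hit)
    have hj' := Set.Ioo_subset_Icc_self hj
    have hpm := HoleData.proj_mem (h.hasHoles.lt j).le x
    have hpx := HoleData.abs_sub_proj_le (H := H j) x hj'
    have hpi := HoleData.abs_proj_sub_le (H := H j) x hj'
    rw [abs_sub_comm] at hpi
    refine ⟨j, by linarith, ?_, close i (hchain_lo k) hxi ?_, close i (hchain_hi k) hxi ?_⟩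
    · have := mul_le_mul_of_nonneg_left (hpx.trans hxi) hL
      linarith
    · rw [hlo]
      exact ((h.abs_boundary_sub_le j).1 _ hj' _ hpm).trans (mul_le_mul_of_nonneg_left hpi hL)
    · rw [hhi]
      exact ((h.abs_boundary_sub_le j).2 _ hj' _ hpm).trans (mul_le_mul_of_nonneg_left hpi hL)
  · have h0 : X 0 ≤ x := by linarith [hX.first_le, h.left_le j, hj.1]
    have hN : x ≤ X (Fin.last N) := by linarith [hX.le_last, h.le_right j, hj.2]
    have hlt : (0 : Fin (N + 1)) < Fin.last N := by
      refine hX.strictMono.lt_iff_lt.1 ?_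
      linarith [hX.first_le, h.left_le j, h.hasHoles.lt j, hX.le_last, h.le_right j]
    obtain ⟨i, i', hii', -, -, hi, hi'⟩ := IsGrid.exists_step X hlt h0 hN
    have hstep := hX.step_le i i' hii'
    have hxi : |x - X i| ≤ μ := by rw [abs_of_nonneg (by linarith)]; linarith
    by_cases hmem : X i ∈ Set.Ioo (H j).c (H j).d
    · right
      obtain ⟨k, ⟨hs, ht, hlo, hhi⟩, -⟩ := hgap i _ _ (h.isGap hmem)
      have hmem' := Set.Ioo_subset_Icc_self hmem
      refine ⟨k, ⟨(hX.strictMono hs).le.trans hi, hi'.trans (hX.strictMono.monotone ?_)⟩,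
        close i (hchain_lo k) hxi ?_, close i (hchain_hi k) hxi ?_⟩
      · rw [Fin.lt_def] at ht
        exact Fin.le_def.2 (by omega)
      · rw [hlo, abs_sub_comm x]; exact (h.abs_boundary_sub_le j).1 _ hmem' _ hj
      · rw [hhi, abs_sub_comm x]; exact (h.abs_boundary_sub_le j).2 _ hmem' _ hj
    -- the hole is not seen in the sample before `x`, so it begins between this sample and `x`, and its
    -- width at `x` is at most `2 L μ`
    · left
      have hcmem : (H j).c ∈ Set.Icc (H j).c (H j).d := ⟨le_rfl, (h.hasHoles.lt j).le⟩
      by_cases hd : x = (H j).d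
      · rw [hd, ← h.hasHoles.eq_right j]
        linarith
      have hxd := lt_of_le_of_ne hj.2 hd
      have hic : X i ≤ (H j).c := by
        by_contra! hc
        exact hmem ⟨hc, hi.trans_lt hxd⟩
      have hxc : |x - (H j).c| ≤ μ := by
        rw [abs_of_nonneg (by linarith [hj.1])]; linarith
      have h1 := (abs_le.1 ((h.abs_boundary_sub_le j).1 _ hj _ hcmem)).1
      have h2 := (abs_le.1 ((h.abs_boundary_sub_le j).2 _ hj _ hcmem)).2
      have h3 := mul_le_mul_of_nonneg_left hxc hL
      have h4 := h.hasHoles.eq_left j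
      linarith

theorem error_terms_le {a b L : ℝ} (hab : a < b) (hL : 0 ≤ L) {N : ℕ} (hN : 3 ≤ N) :
    interpolationError a b L N + (2 * L + 1) * ((b - a) * Real.pi / ((N : ℝ) + 1)) ≤
      Real.pi * (b - a) * (62 * L + 1) * (Real.log N / N) := by
  have hN' : (3 : ℝ) ≤ N := by exact_mod_cast hN
  have hN0 : (0 : ℝ) < N := by linarith
  have hba : 0 < b - a := by linarith
  have hπ := Real.pi_pos
  have hlog1 : 1 ≤ Real.log N := by
    rw [Real.le_log_iff_exp_le hN0]
    linarith [Real.exp_one_lt_d9]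
  have hlog2 : Real.log ((N : ℝ) + 1) ≤ 1 + Real.log N := by
    have h1 : Real.log ((N : ℝ) + 1) ≤ Real.log (2 * N) :=
      Real.log_le_log (by linarith) (by linarith)
    rw [Real.log_mul two_ne_zero hN0.ne'] at h1
    linarith [Real.log_two_lt_d9]
  have h1 : (1 + Real.log ((N : ℝ) + 1)) / ((N : ℝ) + 1) ≤ 3 * (Real.log N / N) := by
    rw [← mul_div_assoc]
    exact div_le_div₀ (by linarith) (by linarith) hN0 (by linarith)
  have h2 : 1 / ((N : ℝ) + 1) ≤ Real.log N / N :=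
    div_le_div₀ (by linarith) hlog1 hN0 (by linarith)
  calc interpolationError a b L N + (2 * L + 1) * ((b - a) * Real.pi / ((N : ℝ) + 1))
      = 20 * Real.pi * L * (b - a) * ((1 + Real.log ((N : ℝ) + 1)) / ((N : ℝ) + 1)) +
        (2 * L + 1) * ((b - a) * Real.pi) * (1 / ((N : ℝ) + 1)) := by
        rw [interpolationError]; ring
    _ ≤ 20 * Real.pi * L * (b - a) * (3 * (Real.log N / N)) +
        (2 * L + 1) * ((b - a) * Real.pi) * (Real.log N / N) := by gcongr
    _ = _ := by ring

theorem tendsto_log_div_nat : Tendsto (fun N : ℕ => Real.log N / N) atTop (𝓝 0) := by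
  have h := (Real.tendsto_pow_log_div_mul_add_atTop 1 0 1 one_ne_zero).comp
    tendsto_natCast_atTop_atTop
  simpa [Function.comp_def] using h

end SVF

theorem theorem3p1 (a b L : ℝ) (hab : a < b) (M : ℕ) (F : ℝ → Set ℝ)
    (hLip : SVF.IsLip a b L F) (hF : SVF.MemClass a b M F) :
    ∃ (C : ℝ) (N₀ : ℕ), ∀ N : ℕ, N₀ ≤ N →
      (∃ G : ℝ → Set ℝ, SVF.IsOutput (SVF.chebyshevPoint a b N)
        (fun i => F (SVF.chebyshevPoint a b N i)) G) ∧
      ∀ G : ℝ → Set ℝ, SVF.IsOutput (SVF.chebyshevPoint a b N)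
        (fun i => F (SVF.chebyshevPoint a b N i)) G →
        ∀ x ∈ Set.Icc a b, (G x).Nonempty ∧ IsCompact (G x) ∧
          Metric.hausdorffDist (G x) (F x) ≤ C * (Real.log N / N) := by
  obtain ⟨δ, H, h⟩ := hF.exists_hasSeparatedHoles hab hLip
  have hL := h.L_nonneg
  set A := Real.pi * (b - a) * (62 * L + 1) with hA
  have hsmall : ∀ᶠ N : ℕ in Filter.atTop, 4 * (A * (Real.log N / N)) < δ := by
    have ht := (SVF.tendsto_log_div_nat.const_mul A).const_mul 4
    rw [mul_zero, mul_zero] at ht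
    exact ht.eventually_lt_const h.pos
  obtain ⟨N₁, hN₁⟩ := Filter.eventually_atTop.1 hsmall
  refine ⟨2 * A, max 3 N₁, fun N hN => ?_⟩
  have hN3 : 3 ≤ N := (le_max_left _ _).trans hN
  have hεδ := hN₁ N ((le_max_right _ _).trans hN)
  have hε := SVF.error_terms_le hab hL hN3
  rw [← hA] at hε
  have hX := SVF.chebyshevPoint_isGrid hab N
  set μ := (b - a) * Real.pi / ((N : ℝ) + 1) with hμ
  have hμ0 : 0 ≤ μ := (sub_nonneg.2 (hX.mem 0).1).trans hX.first_le
  have hLμ0 : 0 ≤ L * μ := mul_nonneg hL hμ0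
  have hI0 : 0 ≤ SVF.interpolationError a b L N := SVF.interpolationError_nonneg hab.le hL N
  refine ⟨h.exists_isOutput hX (by linarith) (by linarith), fun G hG x hx => ?_⟩
  have := h.hausdorffDist_output_le hX (by linarith) hε hεδ hG hx
  rwa [← mul_assoc] at this
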